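/- **Setting.** For a first-order language $\Sigma$ with equality, finitely many of whose predicate symbols are *inductive*, and a finite set $\Phi$ of productions (rules whose premises are finitely many atomic formulas with predicate symbols of $\Sigma$ and whose conclusion is an atomic formula with an inductive predicate), $\mathrm{LKID}(\Sigma,\Phi)$ is Martin-Löf-style classical sequent calculus with inductive definitions: sequents $\Gamma\vdash\Delta$ of finite sets of formulas; the usual rules of classical first-order sequent calculus with equality, including cut, weakening and substitution; for each production a right-introduction rule; and for each inductive predicate $P_j$ the induction rule which derives $\Gamma,P_j\vec u\vdash\Delta$ from $\Gamma,F_j\vec u\vdash\Delta$ and one minor premise for every production whose conclusion is a predicate mutually dependent with $P_j$, for arbitrary induction-hypothesis formulas $F_i$. Let $\Sigma_N=\{0,s,N,p\}$, where $N$ is a unary inductive predicate and $p$ is an ordinary binary predicate, and let $\Phi_N$ consist of the productions $N(0)$ and $N(x)\Rightarrow N(sx)$. Let $\Sigma_N+\{\le\}$ be $\Sigma_N$ with an additional binary inductive predicate $\le$, and let $\Phi_\le$ consist of the productions $x\le x$ and $x\le y\Rightarrow x\le sy$. Write $\forall x\in N.\,A$ for $\forall x.(N(x)\to A)$, write $\forall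 x,y\in N.\,A$ for $\forall x.\forall y.(N(x)\wedge N(y)\to A)$, and $1$ for $s0$. The $0$-axiom is $\forall x\in N.\ sx\ne 0$; the $s$-axiom is $\forall x,y\in N.\ sx=sy\to x=y$. Let $H$ be the formula $H_a\wedge H_b\wedge H_c\wedge H_d\to\forall x,y\in N.\ p(x,y)$, where - $H_a$ is $\forall x\in N.\ p(0,0)\wedge p(1,0)\wedge p(x,1)$, - $H_b$ is $\forall x,y\in N.\ p(x,y)\to p(sx,ssy)$, - $H_c$ is $\forall y\in N.\ p(sy,y)\to p(0,ssy)$, - $H_d$ is $\forall x\in N.\ p(sx,x)\to p(ssx,0)$. **Theorem (Non-Conservativity).** $\mathrm{LKID}(\Sigma_N+\{\le\},\Phi_N+\Phi_\le)$ is an extension of $\mathrm{LKID}(\Sigma_N,\Phi_N)$ (it has a larger language and more productions, and proves every sequent that $\mathrm{LKID}(\Sigma_N,\Phi_N)$ proves), but it is not conservative over $\mathrm{LKID}(\Sigma_N,\Phi_N)$. In particular, the sequent $$0\text{-axiom},\ s\text{-axiom}\ \vdash\ H,$$ which is in the language $\Sigma_N$, is provable in $\mathrm{LKID}(\Sigma_N+\{\le\},\Phi_N+\Phi_\le)$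 and is not provable in $\mathrm{LKID}(\Sigma_N,\Phi_N)$. -/

import Mathlib

namespace LKID

open FirstOrder FirstOrder.Language

/-! Syntax: first-order logic with equality and all connectives primitive.  Terms are Mathlib's
terms over variables named by natural numbers.  Bound variables are nameless (de Bruijn indices):
under a quantifier the index `0` is the bound variable and the index `n + 1` is the outer
variable `n`.  So formulas are identified up to renaming of bound variables, and outside all
quantifiers a natural number is simply the name of a free variable. -/

/-- The predicate symbols of a language, bundled with their arities. -/
abbrev PredSym (L : FirstOrder.Language.{0, 0}) : Type := Σ k : ℕ, L.Relations k

/-- An atomic formula (other than an equation): a predicate symbol applied to terms. -/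
structure Atom (L : FirstOrder.Language.{0, 0}) (α : Type) where
  pred : PredSym L
  args : Fin pred.1 → L.Term α

/-- Simultaneous substitution of terms for the variables of an atomic formula. -/
def Atom.subst {L : FirstOrder.Language.{0, 0}} {α β : Type} (a : Atom L α) (σ : α → L.Term β) :
    Atom L β :=
  ⟨a.pred, fun i => (a.args i).subst σ⟩

/-- Translation of an atomic formula along a map of languages. -/
def Atom.map {L L' : FirstOrder.Language.{0, 0}} {α : Type} (φ : L →ᴸ L') (a : Atom L α) : Atom L' α :=
  ⟨⟨a.pred.1, φ.onRelation a.pred.2⟩, fun i => φ.onTerm (a.args i)⟩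

/-- First-order formulas with equality. -/
inductive Form (L : FirstOrder.Language.{0, 0}) : Type
  | eq (t u : L.Term ℕ) : Form L
  | atom (a : Atom L ℕ) : Form L
  | neg (F : Form L) : Form L
  | and (F G : Form L) : Form L
  | or (F G : Form L) : Form L
  | imp (F G : Form L) : Form L
  | all (F : Form L) : Form L
  | ex (F : Form L) : Form L

noncomputable instance (L : FirstOrder.Language.{0, 0}) : DecidableEq (Form L) := Classical.decEq _

/-- The substitution `σ` moved under a quantifier. -/
def liftSubst {L : FirstOrder.Language.{0, 0}} (σ : ℕ → L.Term ℕ) : ℕ → L.Term ℕ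
  | 0 => Term.var 0
  | n + 1 => (σ n).relabel Nat.succ

/-- Capture-avoiding simultaneous substitution. -/
def Form.subst {L : FirstOrder.Language.{0, 0}} : Form L → (ℕ → L.Term ℕ) → Form L
  | .eq t u, σ => .eq (t.subst σ) (u.subst σ)
  | .atom a, σ => .atom (a.subst σ)
  | .neg F, σ => .neg (F.subst σ)
  | .and F G, σ => .and (F.subst σ) (G.subst σ)
  | .or F G, σ => .or (F.subst σ) (G.subst σ)
  | .imp F G, σ => .imp (F.subst σ) (G.subst σ)
  | .all F, σ => .all (F.subst (liftSubst σ))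
  | .ex F, σ => .ex (F.subst (liftSubst σ))

/-- The instance `F[t/x]` of the body `F` of a quantified formula `∀ x. F` or `∃ x. F`. -/
def Form.inst {L : FirstOrder.Language.{0, 0}} (F : Form L) (t : L.Term ℕ) : Form L :=
  F.subst (fun n => match n with
    | 0 => t
    | m + 1 => Term.var m)

/-- The free variables of a formula. -/
def Form.fv {L : FirstOrder.Language.{0, 0}} : Form L → Set ℕ
  | .eq t u => {n | n ∈ t.varFinset ∨ n ∈ u.varFinset}
  | .atom a => {n | ∃ i, n ∈ (a.args i).varFinset}
  | .neg F => F.fv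
  | .and F G => F.fv ∪ G.fv
  | .or F G => F.fv ∪ G.fv
  | .imp F G => F.fv ∪ G.fv
  | .all F => {n | n + 1 ∈ F.fv}
  | .ex F => {n | n + 1 ∈ F.fv}

/-- Translation of a formula along a map of languages. -/
def Form.map {L L' : FirstOrder.Language.{0, 0}} (φ : L →ᴸ L') : Form L → Form L'
  | .eq t u => .eq (φ.onTerm t) (φ.onTerm u)
  | .atom a => .atom (a.map φ)
  | .neg F => .neg (F.map φ)
  | .and F G => .and (F.map φ) (G.map φ)
  | .or F G => .or (F.map φ) (G.map φ)
  | .imp F G => .imp (F.map φ) (G.map φ)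
  | .all F => .all (F.map φ)
  | .ex F => .ex (F.map φ)

/-- The variable `x` does not occur free in any formula of the finite set `Γ`. -/
def Fresh {L : FirstOrder.Language.{0, 0}} (x : ℕ) (Γ : Finset (Form L)) : Prop := ∀ F ∈ Γ, x ∉ F.fv

/-- `Γ[σ]`: a substitution applied to all formulas of a finite set. -/
noncomputable def substAll {L : FirstOrder.Language.{0, 0}} (Γ : Finset (Form L)) (σ : ℕ → L.Term ℕ) :
    Finset (Form L) :=
  Γ.image (fun F => F.subst σ)

/-- The substitution `[t/x, u/y]` (used for `x ≠ y`). -/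
def subst2 {L : FirstOrder.Language.{0, 0}} (x y : ℕ) (t u : L.Term ℕ) : ℕ → L.Term ℕ :=
  Function.update (Function.update Term.var x t) y u

/-! Inductive definition systems. -/

/-- A production: finitely many atomic premises and an atomic conclusion, whose variables are
`x_0, …, x_{nvars - 1}`. -/
structure Production (L : FirstOrder.Language.{0, 0}) where
  nvars : ℕ
  premises : List (Atom L (Fin nvars))
  concl : Atom L (Fin nvars)

/-- Translation of a production along a map of languages. -/
def Production.map {L L' : FirstOrder.Language.{0, 0}} (φ : L →ᴸ L') (π : Production L) : Production L' :=
  ⟨π.nvars, π.premises.map (Atom.map φ), π.concl.map φ⟩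

/-- An inductive definition system `(Σ, Φ)`: a first-order language, finitely many of whose
predicate symbols are the inductive ones (the others are ordinary), and a finite set of
productions whose conclusions are inductive predicates. -/
structure IndDefSystem where
  L : FirstOrder.Language.{0, 0}
  ind : Set (PredSym L)
  ind_finite : ind.Finite
  prods : Set (Production L)
  prods_finite : prods.Finite
  concl_mem : ∀ π ∈ prods, π.concl.pred ∈ ind

/-- `Q` is a premise of `P`: both are inductive and some production for `P` has `Q` among its
premises. -/
def IndDefSystem.IsPremise (S : IndDefSystem) (P Q : PredSym S.L) : Prop :=
  P ∈ S.ind ∧ Q ∈ S.ind ∧ ∃ π ∈ S.prods, π.concl.pred = P ∧ ∃ a ∈ π.premises, a.pred = Q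

/-- Mutual dependency: chains (possibly empty) of the premise relation in both directions. -/
def IndDefSystem.MutDep (S : IndDefSystem) (P Q : PredSym S.L) : Prop :=
  Relation.ReflTransGen S.IsPremise P Q ∧ Relation.ReflTransGen S.IsPremise Q P

/-- `F t⃗ = F[t⃗ / z⃗]` for a tuple `z⃗` of distinct variables. -/
noncomputable def Form.substVec {L : FirstOrder.Language.{0, 0}} {k : ℕ} (F : Form L) (z : Fin k → ℕ)
    (t : Fin k → L.Term ℕ) : Form L :=
  F.subst (Function.extend z t Term.var)

/-- The formula `F_i t⃗` attached to an atom `P_i t⃗`, where `z` and `F` give the induction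
variables and the induction hypothesis of every predicate. -/
noncomputable def hypAt {L : FirstOrder.Language.{0, 0}} (z : ∀ Q : PredSym L, Fin Q.1 → ℕ)
    (F : PredSym L → Form L) (a : Atom L ℕ) : Form L :=
  (F a.pred).substVec (z a.pred) a.args

open Classical in
/-- The formula `G_i t⃗` attached to an atom `P_i t⃗` in the induction rule for `P`: it is `F_i t⃗`
if `P_i` and `P` are mutually dependent, and the atom itself otherwise. -/
noncomputable def IndDefSystem.indHyp (S : IndDefSystem) (P : PredSym S.L)
    (z : ∀ Q : PredSym S.L, Fin Q.1 → ℕ) (F : PredSym S.L → Form S.L) (a : Atom S.L ℕ) :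
    Form S.L :=
  if S.MutDep a.pred P then hypAt z F a else .atom a

/-- `S.Provable Γ Δ`: the sequent `Γ ⊢ Δ` has a (finite) proof in `LKID(Σ, Φ)`. -/
inductive IndDefSystem.Provable (S : IndDefSystem) :
    Finset (Form S.L) → Finset (Form S.L) → Prop
  -- structural rules
  | ax {Γ Δ : Finset (Form S.L)} (h : (Γ ∩ Δ).Nonempty) : Provable S Γ Δ
  | wk {Γ Γ' Δ Δ' : Finset (Form S.L)} (hΓ : Γ ⊆ Γ') (hΔ : Δ ⊆ Δ') (h : Provable S Γ Δ) :
      Provable S Γ' Δ'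
  | cut {Γ Δ : Finset (Form S.L)} (F : Form S.L) (h₁ : Provable S Γ (insert F Δ))
      (h₂ : Provable S (insert F Γ) Δ) : Provable S Γ Δ
  | subst {Γ Δ : Finset (Form S.L)} (θ : ℕ → S.L.Term ℕ) (h : Provable S Γ Δ) :
      Provable S (substAll Γ θ) (substAll Δ θ)
  -- logical rules
  | negL {Γ Δ : Finset (Form S.L)} {F : Form S.L} (h : Provable S Γ (insert F Δ)) :
      Provable S (insert (.neg F) Γ) Δ
  | negR {Γ Δ : Finset (Form S.L)} {F : Form S.L} (h : Provable S (insert F Γ) Δ) :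
      Provable S Γ (insert (.neg F) Δ)
  | orL {Γ Δ : Finset (Form S.L)} {F G : Form S.L} (h₁ : Provable S (insert F Γ) Δ)
      (h₂ : Provable S (insert G Γ) Δ) : Provable S (insert (.or F G) Γ) Δ
  | orR {Γ Δ : Finset (Form S.L)} {F G : Form S.L}
      (h : Provable S Γ (insert F (insert G Δ))) : Provable S Γ (insert (.or F G) Δ)
  | andL {Γ Δ : Finset (Form S.L)} {F G : Form S.L}
      (h : Provable S (insert F (insert G Γ)) Δ) : Provable S (insert (.and F G) Γ) Δ
  | andR {Γ Δ : Finset (Form S.L)} {F G : Form S.L} (h₁ : Provable S Γ (insert F Δ))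
      (h₂ : Provable S Γ (insert G Δ)) : Provable S Γ (insert (.and F G) Δ)
  | impL {Γ Δ : Finset (Form S.L)} {F G : Form S.L} (h₁ : Provable S Γ (insert F Δ))
      (h₂ : Provable S (insert G Γ) Δ) : Provable S (insert (.imp F G) Γ) Δ
  | impR {Γ Δ : Finset (Form S.L)} {F G : Form S.L}
      (h : Provable S (insert F Γ) (insert G Δ)) : Provable S Γ (insert (.imp F G) Δ)
  | exL {Γ Δ : Finset (Form S.L)} {F : Form S.L} (x : ℕ) (hΓ : Fresh x Γ) (hΔ : Fresh x Δ)
      (hF : x ∉ (Form.ex F).fv) (h : Provable S (insert (F.inst (Term.var x)) Γ) Δ) :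
      Provable S (insert (.ex F) Γ) Δ
  | exR {Γ Δ : Finset (Form S.L)} {F : Form S.L} (t : S.L.Term ℕ)
      (h : Provable S Γ (insert (F.inst t) Δ)) : Provable S Γ (insert (.ex F) Δ)
  | allL {Γ Δ : Finset (Form S.L)} {F : Form S.L} (t : S.L.Term ℕ)
      (h : Provable S (insert (F.inst t) Γ) Δ) : Provable S (insert (.all F) Γ) Δ
  | allR {Γ Δ : Finset (Form S.L)} {F : Form S.L} (x : ℕ) (hΓ : Fresh x Γ) (hΔ : Fresh x Δ)
      (hF : x ∉ (Form.all F).fv) (h : Provable S Γ (insert (F.inst (Term.var x)) Δ)) :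
      Provable S Γ (insert (.all F) Δ)
  | eqL {Γ Δ : Finset (Form S.L)} (x y : ℕ) (hxy : x ≠ y) (t u : S.L.Term ℕ)
      (h : Provable S (substAll Γ (subst2 x y u t)) (substAll Δ (subst2 x y u t))) :
      Provable S (insert (.eq t u) (substAll Γ (subst2 x y t u))) (substAll Δ (subst2 x y t u))
  | eqR {Γ Δ : Finset (Form S.L)} (t : S.L.Term ℕ) : Provable S Γ (insert (.eq t t) Δ)
  -- right introduction of an inductive predicate, one rule for each production
  | prodR {Γ Δ : Finset (Form S.L)} (π : Production S.L) (hπ : π ∈ S.prods)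
      (u : Fin π.nvars → S.L.Term ℕ)
      (h : ∀ a ∈ π.premises, Provable S Γ (insert (.atom (a.subst u)) Δ)) :
      Provable S Γ (insert (.atom (π.concl.subst u)) Δ)
  -- the induction rule for the inductive predicate `P`, with induction variables `z`, induction
  -- hypotheses `F`, and for every production a tuple `y` of distinct fresh variables
  | ind {Γ Δ : Finset (Form S.L)} (P : PredSym S.L) (hP : P ∈ S.ind)
      (u : Fin P.1 → S.L.Term ℕ)
      (z : ∀ Q : PredSym S.L, Fin Q.1 → ℕ) (hz : ∀ Q, Function.Injective (z Q))
      (F : PredSym S.L → Form S.L)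
      (y : ∀ π : Production S.L, Fin π.nvars → ℕ) (hy : ∀ π, Function.Injective (y π))
      (hyΓ : ∀ π i, Fresh (y π i) Γ) (hyΔ : ∀ π i, Fresh (y π i) Δ)
      (hyF : ∀ π i Q, S.MutDep Q P → y π i ∉ (F Q).fv)
      (hminor : ∀ π ∈ S.prods, S.MutDep π.concl.pred P →
        Provable S
          (Γ ∪ (π.premises.map
            (fun a => S.indHyp P z F (a.subst (fun i => Term.var (y π i))))).toFinset)
          (insert (hypAt z F (π.concl.subst (fun i => Term.var (y π i)))) Δ))
      (hmajor : Provable S (insert (hypAt z F ⟨P, u⟩) Γ) Δ) :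
      Provable S (insert (.atom ⟨P, u⟩) Γ) Δ

/-! Extensions and conservativity. -/

/-- The map of predicate symbols induced by a map of languages. -/
def mapPred {L L' : FirstOrder.Language.{0, 0}} (φ : L →ᴸ L') (P : PredSym L) : PredSym L' :=
  ⟨P.1, φ.onRelation P.2⟩

/-- Translation of a finite set of formulas along a map of languages. -/
noncomputable def mapAll {L L' : FirstOrder.Language.{0, 0}} (φ : L →ᴸ L') (Γ : Finset (Form L)) :
    Finset (Form L') :=
  Γ.image (Form.map φ)

/-- Along `φ`, the system `S₂` is an extension of `S₁`: the language of `S₁` is a sublanguage, its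
inductive (ordinary) predicates are inductive (ordinary) in `S₂`, its productions are productions
of `S₂`, and all sequents provable in `S₁` are provable in `S₂`. -/
structure IsExtension (S₁ S₂ : IndDefSystem) (φ : S₁.L →ᴸ S₂.L) : Prop where
  injective : φ.Injective
  ind_iff : ∀ P : PredSym S₁.L, mapPred φ P ∈ S₂.ind ↔ P ∈ S₁.ind
  prods_subset : ∀ π ∈ S₁.prods, π.map φ ∈ S₂.prods
  provable : ∀ Γ Δ : Finset (Form S₁.L),
    S₁.Provable Γ Δ → S₂.Provable (mapAll φ Γ) (mapAll φ Δ)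

/-- Along `φ`, the system `S₂` is conservative over `S₁`: every sequent in the language of `S₁`
that is provable in `S₂` is provable in `S₁`. -/
def IsConservative (S₁ S₂ : IndDefSystem) (φ : S₁.L →ᴸ S₂.L) : Prop :=
  ∀ Γ Δ : Finset (Form S₁.L), S₂.Provable (mapAll φ Γ) (mapAll φ Δ) → S₁.Provable Γ Δ

/-! The language `0, s, N, p` and the system for natural numbers. -/

/-- Function symbols: the constant `0` and the successor `s`. -/
inductive NFunc : ℕ → Type
  | zero : NFunc 0
  | succ : NFunc 1

/-- Predicate symbols: the inductive predicate `N` and the ordinary binary predicate `p`. -/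
inductive NPred : ℕ → Type
  | nat : NPred 1
  | p : NPred 2

/-- The language `Σ_N`. -/
def langN : FirstOrder.Language.{0, 0} := ⟨NFunc, NPred⟩

/-- The term `0`. -/
def zero {α : Type} : langN.Term α := Term.func (L := langN) NFunc.zero ![]

/-- The term `s t`. -/
def succ {α : Type} (t : langN.Term α) : langN.Term α := Term.func (L := langN) NFunc.succ ![t]

/-- The atom `N t`. -/
def natAtom {α : Type} (t : langN.Term α) : Atom langN α := ⟨⟨1, NPred.nat⟩, ![t]⟩

/-- The production `N 0`. -/
def prodNZero : Production langN := ⟨0, [], natAtom zero⟩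

/-- The production `N x ⟹ N (s x)`. -/
def prodNSucc : Production langN :=
  ⟨1, [natAtom (Term.var 0)], natAtom (succ (Term.var 0))⟩

/-- The system `(Σ_N, Φ_N)`. -/
abbrev sysN : IndDefSystem where
  L := langN
  ind := {⟨1, NPred.nat⟩}
  ind_finite := Set.finite_singleton _
  prods := {prodNZero, prodNSucc}
  prods_finite := Set.toFinite _
  concl_mem := by
    rintro π (rfl | rfl) <;> rfl

/-! Adding the inductive predicate `≤`. -/

/-- The additional binary predicate symbol `≤`. -/
inductive LePred : ℕ → Type
  | le : LePred 2

/-- The language `Σ_N + {≤}`. -/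
def langNLe : FirstOrder.Language.{0, 0} := langN.sum ⟨fun _ => Empty, LePred⟩

/-- The inclusion of `Σ_N` into `Σ_N + {≤}`. -/
def incl : langN →ᴸ langNLe := LHom.sumInl

/-- The predicate symbol `≤` of `Σ_N + {≤}`. -/
def leSym : PredSym langNLe := ⟨2, Sum.inr LePred.le⟩

/-- The atom `t ≤ u`. -/
def leAtom {α : Type} (t u : langNLe.Term α) : Atom langNLe α := ⟨leSym, ![t, u]⟩

/-- The term `s t` of the extended language. -/
def succLe {α : Type} (t : langNLe.Term α) : langNLe.Term α :=
  Term.func (incl.onFunction (show langN.Functions 1 from NFunc.succ)) ![t]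

/-- The production `x ≤ x`. -/
def prodLeRefl : Production langNLe := ⟨1, [], leAtom (Term.var 0) (Term.var 0)⟩

/-- The production `x ≤ y ⟹ x ≤ s y`. -/
def prodLeSucc : Production langNLe :=
  ⟨2, [leAtom (Term.var 0) (Term.var 1)], leAtom (Term.var 0) (succLe (Term.var 1))⟩

/-- The system `(Σ_N + {≤}, Φ_N + Φ_≤)`. -/
abbrev sysNLe : IndDefSystem where
  L := langNLe
  ind := {mapPred incl ⟨1, NPred.nat⟩, leSym}
  ind_finite := Set.toFinite _
  prods := {prodNZero.map incl, prodNSucc.map incl, prodLeRefl, prodLeSucc}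
  prods_finite := Set.toFinite _
  concl_mem := by
    rintro π (rfl | rfl | rfl | rfl)
    · exact Or.inl rfl
    · exact Or.inl rfl
    · exact Or.inr rfl
    · exact Or.inr rfl

/-! The `(0, s)`-axioms and the 2-Hydra statement, in the language `Σ_N`. -/

/-- The formula `N t`. -/
def nat (t : langN.Term ℕ) : Form langN := .atom (natAtom t)

/-- The formula `p(t, u)`. -/
def p (t u : langN.Term ℕ) : Form langN := .atom ⟨⟨2, NPred.p⟩, ![t, u]⟩

/-- `∀ x ∈ N. A`, where `x` is the index `0` in `A`. -/
def allN (A : Form langN) : Form langN := .all (.imp (nat (Term.var 0)) A)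

/-- `∀ x, y ∈ N. A`, where `x` is the index `1` and `y` the index `0` in `A`. -/
def allN2 (A : Form langN) : Form langN :=
  .all (.all (.imp (.and (nat (Term.var 1)) (nat (Term.var 0))) A))

/-- The axiom that `0` is not a successor: `∀ x ∈ N. s x ≠ 0`. -/
def zeroAx : Form langN := allN (.neg (.eq (succ (Term.var 0)) zero))

/-- The axiom that the successor is injective: `∀ x, y ∈ N. s x = s y → x = y`. -/
def succAx : Form langN :=
  allN2 (.imp (.eq (succ (Term.var 1)) (succ (Term.var 0))) (.eq (Term.var 1) (Term.var 0)))

/-- `∀ x ∈ N. p(0, 0) ∧ p(1, 0) ∧ p(x, 1)`. -/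
def hydraA : Form langN :=
  allN (.and (p zero zero) (.and (p (succ zero) zero) (p (Term.var 0) (succ zero))))

/-- `∀ x, y ∈ N. p(x, y) → p(s x, s s y)`. -/
def hydraB : Form langN :=
  allN2 (.imp (p (Term.var 1) (Term.var 0)) (p (succ (Term.var 1)) (succ (succ (Term.var 0)))))

/-- `∀ y ∈ N. p(s y, y) → p(0, s s y)`. -/
def hydraC : Form langN :=
  allN (.imp (p (succ (Term.var 0)) (Term.var 0)) (p zero (succ (succ (Term.var 0)))))

/-- `∀ x ∈ N. p(s x, x) → p(s s x, 0)`. -/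
def hydraD : Form langN :=
  allN (.imp (p (succ (Term.var 0)) (Term.var 0)) (p (succ (succ (Term.var 0))) zero))

/-- The 2-Hydra statement `H`. -/
def hydra : Form langN :=
  .imp (.and hydraA (.and hydraB (.and hydraC hydraD)))
    (allN2 (p (Term.var 1) (Term.var 0)))

end LKID

/-!
The proof is semantic: `LKID` is sound and complete for Henkin models, that is, structures in which
the productions hold and in which induction holds for all predicates that are first-order definable
with parameters (`IndDefSystem.Provable.sound`, `IndDefSystem.provable_of_valid`). Completeness is
the usual Lindenbaum construction with fresh variables as witnesses, followed by the observation
that the induction principle can be written as one provable sequent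
(`IndDefSystem.provable_induction`).

*Extension.* A Henkin model of the large system, with `≤` forgotten, is a Henkin model of the small
one, so soundness for the small system and completeness for the large one give the inclusion of
provable sequents.

*Provability of the 2-Hydra statement with `≤`.* Every rule `H_b`, `H_c`, `H_d` proves `p` at a pair
from `p` at a pair with a smaller maximum. With `≤` one can express that `p(x, y)` holds for all
`x, y ≤ n`, and induction on `n` proves it (`pVal_of_hydraHyp`).

*Unprovability without `≤`.* The countermodel is `ℕ + ℤ` with `N` true everywhere, the element `z`
of `ℤ` being thought of as `ω + z`. The relation `p` is the complement of the graph of a doubling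
function `dbl`, which maps `n` to `ω + 2n`, maps `ω + n` to `2n`, and maps `ω - n` to `ω - 2n` for
`n > 0`. The complement of the graph is what the hypotheses of the 2-Hydra statement require, because
`dbl (x + 1) = dbl x + 2` except where `dbl` jumps from `ω - 2` to `0`, and `p(0, ω)` fails.
Induction for definable predicates is a back-and-forth argument: successor and doubling move offsets
by `z ↦ z + 1` and `z ↦ 2z`, so a formula only sees an element through bounded coincidences
`2^m y = 2^l x + c` with the parameters, with `0` and with `ω`, and through its offset modulo a power
of two (`NatInt.exists_push`, `NatInt.exists_approx_form`). Hence a definable set is periodic far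
from `ω` and the parameters, with the same period and pattern on the standard and the nonstandard
half-lines (`NatInt.exists_periodic`). If it contains `0` and is closed under successor, it contains
`ℕ`, so all remote elements, among them elements arbitrarily far below `ω`, and so everything.
-/

namespace LKID

open FirstOrder FirstOrder.Language

/-! ### Semantics of formulas -/

section Semantics

variable {L : FirstOrder.Language.{0, 0}} {M : Type} [L.Structure M]

/-- The valuation that gives the de Bruijn index `0` the value `a` and shifts `ρ` up. -/
def push {X : Type} (a : X) (ρ : ℕ → X) : ℕ → X
  | 0 => a
  | n + 1 => ρ n

@[simp] theorem push_zero {X : Type} (a : X) (ρ : ℕ → X) : push a ρ 0 = a := rfl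

@[simp] theorem push_succ {X : Type} (a : X) (ρ : ℕ → X) (n : ℕ) : push a ρ (n + 1) = ρ n := rfl

/-- Truth of an atomic formula under a valuation of its variables. -/
def Atom.Sat {α : Type} (a : Atom L α) (v : α → M) : Prop :=
  Structure.RelMap a.pred.2 (fun i => (a.args i).realize v)

/-- Tarskian truth of a formula. -/
def Form.Sat : Form L → (ℕ → M) → Prop
  | .eq t u, ρ => t.realize ρ = u.realize ρ
  | .atom a, ρ => a.Sat ρ
  | .neg F, ρ => ¬ F.Sat ρ
  | .and F G, ρ => F.Sat ρ ∧ G.Sat ρ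
  | .or F G, ρ => F.Sat ρ ∨ G.Sat ρ
  | .imp F G, ρ => F.Sat ρ → G.Sat ρ
  | .all F, ρ => ∀ a, F.Sat (push a ρ)
  | .ex F, ρ => ∃ a, F.Sat (push a ρ)

theorem Atom.sat_subst {α β : Type} (a : Atom L α) (σ : α → L.Term β) (v : β → M) :
    (a.subst σ).Sat v ↔ a.Sat (fun i => (σ i).realize v) := by
  simp only [Atom.Sat, Atom.subst, Term.realize_subst]

theorem realize_liftSubst (σ : ℕ → L.Term ℕ) (a : M) (ρ : ℕ → M) :
    (fun n => (liftSubst σ n).realize (push a ρ)) = push a (fun n => (σ n).realize ρ) := by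
  funext n
  cases n with
  | zero => rfl
  | succ n => simp only [liftSubst, Term.realize_relabel, push_succ]; rfl

theorem Form.sat_subst (F : Form L) (σ : ℕ → L.Term ℕ) (ρ : ℕ → M) :
    (F.subst σ).Sat ρ ↔ F.Sat (fun n => (σ n).realize ρ) := by
  induction F generalizing σ ρ with
  | eq t u => simp only [Form.subst, Form.Sat, Term.realize_subst]
  | atom a => exact a.sat_subst σ ρ
  | neg F ih => simp only [Form.subst, Form.Sat, ih]
  | and F G ih₁ ih₂ => simp only [Form.subst, Form.Sat, ih₁, ih₂]
  | or F G ih₁ ih₂ => simp only [Form.subst, Form.Sat, ih₁, ih₂]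
  | imp F G ih₁ ih₂ => simp only [Form.subst, Form.Sat, ih₁, ih₂]
  | all F ih => simp only [Form.subst, Form.Sat, ih, realize_liftSubst]
  | ex F ih => simp only [Form.subst, Form.Sat, ih, realize_liftSubst]

theorem Form.sat_inst (F : Form L) (t : L.Term ℕ) (ρ : ℕ → M) :
    (F.inst t).Sat ρ ↔ F.Sat (push (t.realize ρ) ρ) := by
  rw [Form.inst, Form.sat_subst]
  apply iff_of_eq
  congr 1
  funext n
  cases n <;> rfl

theorem realize_congr (t : L.Term ℕ) {ρ ρ' : ℕ → M} (h : ∀ n ∈ t.varFinset, ρ n = ρ' n) :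
    t.realize ρ = t.realize ρ' := by
  induction t with
  | var n => exact h n (by simp [Term.varFinset])
  | func f ts ih =>
    simp only [Term.realize]
    congr 1
    funext i
    refine ih i fun n hn => h n ?_
    simp only [Term.varFinset, Finset.mem_biUnion]
    exact ⟨i, Finset.mem_univ _, hn⟩

theorem Form.sat_congr (F : Form L) {ρ ρ' : ℕ → M} (h : ∀ n ∈ F.fv, ρ n = ρ' n) :
    F.Sat ρ ↔ F.Sat ρ' := by
  have key : ∀ (F : Form L) (a : M) {ρ ρ' : ℕ → M}, (∀ n, n + 1 ∈ F.fv → ρ n = ρ' n) →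
      ∀ n ∈ F.fv, push a ρ n = push a ρ' n := by
    intro F a ρ ρ' h n hn
    cases n with
    | zero => rfl
    | succ n => exact h n hn
  induction F generalizing ρ ρ' with
  | eq t u =>
    simp only [Form.Sat, realize_congr t fun n hn => h n (Or.inl hn),
      realize_congr u fun n hn => h n (Or.inr hn)]
  | atom a =>
    simp only [Form.Sat, Atom.Sat]
    apply iff_of_eq
    congr 1
    funext i
    exact realize_congr _ fun n hn => h n ⟨i, hn⟩
  | neg F ih => exact not_congr (ih h)
  | and F G ih₁ ih₂ =>
    exact and_congr (ih₁ fun n hn => h n (Or.inl hn)) (ih₂ fun n hn => h n (Or.inr hn))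
  | or F G ih₁ ih₂ =>
    exact or_congr (ih₁ fun n hn => h n (Or.inl hn)) (ih₂ fun n hn => h n (Or.inr hn))
  | imp F G ih₁ ih₂ =>
    exact imp_congr (ih₁ fun n hn => h n (Or.inl hn)) (ih₂ fun n hn => h n (Or.inr hn))
  | all F ih => exact forall_congr' fun a => ih (key F a h)
  | ex F ih => exact exists_congr fun a => ih (key F a h)

theorem Form.sat_map {L' : FirstOrder.Language.{0, 0}} (φ : L →ᴸ L') [L'.Structure M]
    [φ.IsExpansionOn M] (F : Form L) (ρ : ℕ → M) : (F.map φ).Sat ρ ↔ F.Sat ρ := by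
  induction F generalizing ρ with
  | eq t u => simp only [Form.map, Form.Sat, LHom.realize_onTerm]
  | atom a =>
    simp only [Form.map, Form.Sat, Atom.Sat, Atom.map, LHom.realize_onTerm]
    exact iff_of_eq (LHom.map_onRelation (M := M) φ a.pred.2 _)
  | neg F ih => simp only [Form.map, Form.Sat, ih]
  | and F G ih₁ ih₂ => simp only [Form.map, Form.Sat, ih₁, ih₂]
  | or F G ih₁ ih₂ => simp only [Form.map, Form.Sat, ih₁, ih₂]
  | imp F G ih₁ ih₂ => simp only [Form.map, Form.Sat, ih₁, ih₂]
  | all F ih => simp only [Form.map, Form.Sat, ih]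
  | ex F ih => simp only [Form.map, Form.Sat, ih]

variable (M) in
/-- The sequent `Γ ⊢ Δ` is true in `M` under all valuations. -/
def Valid (Γ Δ : Finset (Form L)) : Prop :=
  ∀ ρ : ℕ → M, (∀ F ∈ Γ, F.Sat ρ) → ∃ F ∈ Δ, F.Sat ρ

end Semantics

/-! ### Henkin models and soundness -/

open Classical in
/-- A Henkin model of an inductive definition system: the productions are true, and the inductive
predicates satisfy the induction principle for all families of first-order definable (with
parameters) predicates. -/
structure IndDefSystem.IsHenkinModel (S : IndDefSystem) (M : Type) [S.L.Structure M] : Prop where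
  closed : ∀ π ∈ S.prods, ∀ v : Fin π.nvars → M, (∀ a ∈ π.premises, a.Sat v) → π.concl.Sat v
  induction : ∀ P ∈ S.ind, ∀ z : ∀ Q : PredSym S.L, Fin Q.1 → ℕ,
    (∀ Q, Function.Injective (z Q)) → ∀ (F : PredSym S.L → Form S.L) (ρ : ℕ → M),
    (∀ π ∈ S.prods, S.MutDep π.concl.pred P → ∀ v : Fin π.nvars → M,
      (∀ a ∈ π.premises,
        if S.MutDep a.pred P then
          (F a.pred).Sat (Function.extend (z a.pred) (fun i => (a.args i).realize v) ρ)
        else a.Sat v) →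
      (F π.concl.pred).Sat
        (Function.extend (z π.concl.pred) (fun i => (π.concl.args i).realize v) ρ)) →
    ∀ w : Fin P.1 → M, Structure.RelMap P.2 w → (F P).Sat (Function.extend (z P) w ρ)

theorem sat_hypAt {L : FirstOrder.Language.{0, 0}} {M : Type} [L.Structure M]
    (z : ∀ Q : PredSym L, Fin Q.1 → ℕ) (hz : ∀ Q, Function.Injective (z Q))
    (F : PredSym L → Form L) (a : Atom L ℕ) (ρ : ℕ → M) :
    (hypAt z F a).Sat ρ ↔
      (F a.pred).Sat (Function.extend (z a.pred) (fun i => (a.args i).realize ρ) ρ) := by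
  rw [hypAt, Form.substVec, Form.sat_subst]
  apply iff_of_eq
  congr 1
  funext n
  by_cases h : ∃ i, z a.pred i = n
  · obtain ⟨i, rfl⟩ := h
    rw [(hz _).extend_apply, (hz _).extend_apply]
  · rw [Function.extend_apply' _ _ _ h, Function.extend_apply' _ _ _ h]
    rfl

theorem realize_subst2 {L : FirstOrder.Language.{0, 0}} {M : Type} [L.Structure M] (x y : ℕ)
    {t u : L.Term ℕ} {ρ : ℕ → M} (h : t.realize ρ = u.realize ρ) :
    (fun n => (subst2 x y t u n).realize ρ) = fun n => (subst2 x y u t n).realize ρ := by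
  funext n
  simp only [subst2, Function.update_apply]
  split_ifs <;> simp [h]

theorem exists_sat_insert {L : FirstOrder.Language.{0, 0}} {M : Type} [L.Structure M]
    {F : Form L} {Δ : Finset (Form L)} {ρ : ℕ → M} :
    (∃ G ∈ insert F Δ, G.Sat ρ) ↔ F.Sat ρ ∨ ∃ G ∈ Δ, G.Sat ρ := by
  simp

theorem exists_sat_substAll {L : FirstOrder.Language.{0, 0}} {M : Type} [L.Structure M]
    {Δ : Finset (Form L)} {σ : ℕ → L.Term ℕ} {ρ : ℕ → M} :
    (∃ G ∈ substAll Δ σ, G.Sat ρ) ↔ ∃ G ∈ Δ, G.Sat (fun n => (σ n).realize ρ) := by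
  simp [substAll, Form.sat_subst]

theorem forall_sat_substAll {L : FirstOrder.Language.{0, 0}} {M : Type} [L.Structure M]
    {Δ : Finset (Form L)} {σ : ℕ → L.Term ℕ} {ρ : ℕ → M} :
    (∀ G ∈ substAll Δ σ, G.Sat ρ) ↔ ∀ G ∈ Δ, G.Sat (fun n => (σ n).realize ρ) := by
  simp [substAll, Form.sat_subst]

theorem sat_update_of_fresh {L : FirstOrder.Language.{0, 0}} {M : Type} [L.Structure M] {x : ℕ}
    {F : Form L} (h : x ∉ F.fv) (ρ : ℕ → M) (a : M) : F.Sat (Function.update ρ x a) ↔ F.Sat ρ :=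
  F.sat_congr fun n hn => Function.update_of_ne (by rintro rfl; exact h hn) a ρ

theorem sat_inst_var_update {L : FirstOrder.Language.{0, 0}} {M : Type} [L.Structure M] {x : ℕ}
    {F : Form L} (h : x + 1 ∉ F.fv) (ρ : ℕ → M) (a : M) :
    (F.inst (Term.var x)).Sat (Function.update ρ x a) ↔ F.Sat (push a ρ) := by
  rw [Form.sat_inst]
  refine F.sat_congr fun n hn => ?_
  cases n with
  | zero => simp
  | succ n =>
    have hne : n ≠ x := by rintro rfl; exact h hn
    exact Function.update_of_ne hne a ρ

theorem IndDefSystem.Provable.sound {S : IndDefSystem} {M : Type} [S.L.Structure M]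
    (hM : S.IsHenkinModel M) {Γ Δ : Finset (Form S.L)} (h : S.Provable Γ Δ) : Valid M Γ Δ := by
  classical
  induction h with
  | ax h =>
    obtain ⟨F, hF⟩ := h
    rw [Finset.mem_inter] at hF
    exact fun ρ hρ => ⟨F, hF.2, hρ F hF.1⟩
  | wk hΓ hΔ _ ih =>
    intro ρ hρ
    obtain ⟨F, hF, h⟩ := ih ρ fun F hF => hρ F (hΓ hF)
    exact ⟨F, hΔ hF, h⟩
  | cut F _ _ ih₁ ih₂ =>
    intro ρ hρ
    rcases exists_sat_insert.1 (ih₁ ρ hρ) with h | h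
    · exact ih₂ ρ (Finset.forall_mem_insert _ _ _ |>.2 ⟨h, hρ⟩)
    · exact h
  | subst θ _ ih =>
    intro ρ hρ
    rw [exists_sat_substAll]
    exact ih _ (forall_sat_substAll.1 hρ)
  | negL _ ih =>
    intro ρ hρ
    rw [Finset.forall_mem_insert] at hρ
    exact (exists_sat_insert.1 (ih ρ hρ.2)).resolve_left hρ.1
  | @negR Γ Δ F _ ih =>
    intro ρ hρ
    rw [exists_sat_insert]
    by_cases h : F.Sat ρ
    · exact Or.inr (ih ρ (Finset.forall_mem_insert _ _ _ |>.2 ⟨h, hρ⟩))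
    · exact Or.inl h
  | orL _ _ ih₁ ih₂ =>
    intro ρ hρ
    rw [Finset.forall_mem_insert] at hρ
    rcases hρ.1 with h | h
    · exact ih₁ ρ (Finset.forall_mem_insert _ _ _ |>.2 ⟨h, hρ.2⟩)
    · exact ih₂ ρ (Finset.forall_mem_insert _ _ _ |>.2 ⟨h, hρ.2⟩)
  | orR _ ih =>
    intro ρ hρ
    have := ih ρ hρ
    rw [exists_sat_insert, exists_sat_insert, ← or_assoc] at this
    exact exists_sat_insert.2 this
  | andL _ ih =>
    intro ρ hρ
    rw [Finset.forall_mem_insert] at hρ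
    refine ih ρ ?_
    rw [Finset.forall_mem_insert, Finset.forall_mem_insert]
    exact ⟨hρ.1.1, hρ.1.2, hρ.2⟩
  | andR _ _ ih₁ ih₂ =>
    intro ρ hρ
    rw [exists_sat_insert]
    rcases exists_sat_insert.1 (ih₁ ρ hρ) with h₁ | h₁
    · rcases exists_sat_insert.1 (ih₂ ρ hρ) with h₂ | h₂
      · exact Or.inl ⟨h₁, h₂⟩
      · exact Or.inr h₂
    · exact Or.inr h₁
  | impL _ _ ih₁ ih₂ =>
    intro ρ hρ
    rw [Finset.forall_mem_insert] at hρ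
    rcases exists_sat_insert.1 (ih₁ ρ hρ.2) with h | h
    · exact ih₂ ρ (Finset.forall_mem_insert _ _ _ |>.2 ⟨hρ.1 h, hρ.2⟩)
    · exact h
  | @impR Γ Δ F G _ ih =>
    intro ρ hρ
    rw [exists_sat_insert]
    by_cases h : F.Sat ρ
    · rcases exists_sat_insert.1 (ih ρ (Finset.forall_mem_insert _ _ _ |>.2 ⟨h, hρ⟩)) with h' | h'
      · exact Or.inl fun _ => h'
      · exact Or.inr h'
    · exact Or.inl fun h' => absurd h' h
  | @exL Γ Δ F x hΓ hΔ hF _ ih =>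
    intro ρ hρ
    rw [Finset.forall_mem_insert] at hρ
    obtain ⟨a, ha⟩ := hρ.1
    obtain ⟨G, hG, h⟩ := ih (Function.update ρ x a) (by
      rw [Finset.forall_mem_insert]
      exact ⟨(sat_inst_var_update hF ρ a).2 ha,
        fun G hG => (sat_update_of_fresh (hΓ G hG) ρ a).2 (hρ.2 G hG)⟩)
    exact ⟨G, hG, (sat_update_of_fresh (hΔ G hG) ρ a).1 h⟩
  | exR t _ ih =>
    intro ρ hρ
    rw [exists_sat_insert]
    exact (exists_sat_insert.1 (ih ρ hρ)).imp (fun h => ⟨_, (Form.sat_inst _ t ρ).1 h⟩) id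
  | allL t _ ih =>
    intro ρ hρ
    rw [Finset.forall_mem_insert] at hρ
    exact ih ρ (Finset.forall_mem_insert _ _ _ |>.2
      ⟨(Form.sat_inst _ t ρ).2 (hρ.1 _), hρ.2⟩)
  | @allR Γ Δ F x hΓ hΔ hF _ ih =>
    intro ρ hρ
    rw [exists_sat_insert]
    by_cases hex : ∃ G ∈ Δ, G.Sat ρ
    · exact Or.inr hex
    refine Or.inl fun a => ?_
    rcases exists_sat_insert.1 (ih (Function.update ρ x a) fun G hG =>
      (sat_update_of_fresh (hΓ G hG) ρ a).2 (hρ G hG)) with h | ⟨G, hG, h⟩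
    · exact (sat_inst_var_update hF ρ a).1 h
    · exact absurd ⟨G, hG, (sat_update_of_fresh (hΔ G hG) ρ a).1 h⟩ hex
  | eqL x y hxy t u _ ih =>
    intro ρ hρ
    rw [Finset.forall_mem_insert, forall_sat_substAll] at hρ
    have := ih ρ
    rw [forall_sat_substAll, exists_sat_substAll, ← realize_subst2 x y hρ.1] at this
    exact exists_sat_substAll.2 (this hρ.2)
  | eqR t => exact fun ρ _ => exists_sat_insert.2 (Or.inl rfl)
  | @prodR Γ Δ π hπ u _ ih =>
    intro ρ hρ
    rw [exists_sat_insert]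
    by_cases hex : ∃ G ∈ Δ, G.Sat ρ
    · exact Or.inr hex
    refine Or.inl ((Atom.sat_subst _ _ _).2 (hM.closed π hπ _ fun a ha => ?_))
    exact (Atom.sat_subst _ _ _).1 ((exists_sat_insert.1 (ih a ha ρ hρ)).resolve_right hex)
  | @ind Γ Δ P hP u z hz F y hy hyΓ hyΔ hyF _ _ ih₁ ih₂ =>
    intro ρ hρ
    rw [Finset.forall_mem_insert] at hρ
    by_contra hex
    refine hex (ih₂ ρ (Finset.forall_mem_insert _ _ _ |>.2 ⟨?_, hρ.2⟩))
    refine (sat_hypAt z hz F ⟨P, u⟩ ρ).2 (hM.induction P hP z hz F ρ ?_ _ hρ.1)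
    intro π hπ hdep v hv
    -- The eigenvariables `y π` receive the values `v`; nothing else in the sequent depends on them.
    have hval : (fun i => (Term.var (y π i) : S.L.Term ℕ).realize
        (Function.extend (y π) v ρ)) = v := by
      funext i
      exact (hy π).extend_apply v ρ i
    have hfresh : ∀ {G : Form S.L}, (∀ i, y π i ∉ G.fv) →
        (G.Sat (Function.extend (y π) v ρ) ↔ G.Sat ρ) := fun {G} hG =>
      G.sat_congr fun n hn =>
        Function.extend_apply' _ _ _ (by rintro ⟨i, rfl⟩; exact hG i hn)
    have hF : ∀ (a : Atom S.L (Fin π.nvars)), S.MutDep a.pred P →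
        ((hypAt z F (a.subst fun i => Term.var (y π i))).Sat (Function.extend (y π) v ρ) ↔
        (F a.pred).Sat (Function.extend (z a.pred) (fun i => (a.args i).realize v) ρ)) := by
      intro a ha
      rw [sat_hypAt z hz]
      simp only [Atom.subst, Term.realize_subst, hval]
      refine (F a.pred).sat_congr fun n hn => ?_
      by_cases h : ∃ i, z a.pred i = n
      · obtain ⟨i, rfl⟩ := h
        rw [(hz _).extend_apply, (hz _).extend_apply]
      · rw [Function.extend_apply' _ _ _ h, Function.extend_apply' _ _ _ h]
        exact Function.extend_apply' _ _ _ (by rintro ⟨i, rfl⟩; exact hyF π i _ ha hn)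
    rcases exists_sat_insert.1 (ih₁ π hπ hdep (Function.extend (y π) v ρ) (by
      intro G hG
      rcases Finset.mem_union.1 hG with hG | hG
      · exact (hfresh fun i => hyΓ π i G hG).2 (hρ.2 G hG)
      · rw [List.mem_toFinset, List.mem_map] at hG
        obtain ⟨a, ha, rfl⟩ := hG
        have := hv a ha
        have e : (a.subst fun i => (Term.var (y π i) : S.L.Term ℕ)).pred = a.pred := rfl
        rw [IndDefSystem.indHyp, e]
        by_cases hd : S.MutDep a.pred P
        · rw [if_pos hd] at this
          rw [if_pos hd]
          exact (hF a hd).2 this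
        · rw [if_neg hd] at this
          rw [if_neg hd]
          refine (a.sat_subst _ _).2 ?_
          rwa [hval])) with h | ⟨G, hG, h⟩
    · exact (hF _ hdep).1 h
    · exact absurd ⟨G, hG, (hfresh fun i => hyΔ π i G hG).1 h⟩ hex

/-! ### Substitution calculus -/

section Subst

variable {L : FirstOrder.Language.{0, 0}}

theorem term_subst_relabel {α β γ : Type} (t : L.Term α) (g : α → β) (σ : β → L.Term γ) :
    (t.relabel g).subst σ = t.subst (fun n => σ (g n)) := by
  induction t with
  | var n => rfl
  | func f ts ih => simp only [Term.relabel, Term.subst, ih]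

theorem term_relabel_subst {α β γ : Type} (t : L.Term α) (σ : α → L.Term β) (g : β → γ) :
    (t.subst σ).relabel g = t.subst (fun n => (σ n).relabel g) := by
  induction t with
  | var n => rfl
  | func f ts ih => simp only [Term.relabel, Term.subst, ih]

theorem term_subst_subst {α β γ : Type} (t : L.Term α) (σ : α → L.Term β) (τ : β → L.Term γ) :
    (t.subst σ).subst τ = t.subst (fun n => (σ n).subst τ) := by
  induction t with
  | var n => rfl
  | func f ts ih => simp only [Term.subst, ih]

theorem term_subst_var {α : Type} (t : L.Term α) : t.subst Term.var = t := by
  induction t with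
  | var n => rfl
  | func f ts ih => simp only [Term.subst, ih]

theorem liftSubst_liftSubst (σ τ : ℕ → L.Term ℕ) :
    (fun n => (liftSubst σ n).subst (liftSubst τ)) = liftSubst (fun n => (σ n).subst τ) := by
  funext n
  cases n with
  | zero => rfl
  | succ n => simp only [liftSubst, term_subst_relabel, term_relabel_subst]

theorem liftSubst_var : liftSubst (Term.var : ℕ → L.Term ℕ) = Term.var := by
  funext n
  cases n <;> rfl

theorem Form.subst_subst (F : Form L) (σ τ : ℕ → L.Term ℕ) :
    (F.subst σ).subst τ = F.subst (fun n => (σ n).subst τ) := by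
  induction F generalizing σ τ with
  | eq t u => simp only [Form.subst, term_subst_subst]
  | atom a => simp only [Form.subst, Atom.subst, term_subst_subst]
  | neg F ih => simp only [Form.subst, ih]
  | and F G ih₁ ih₂ => simp only [Form.subst, ih₁, ih₂]
  | or F G ih₁ ih₂ => simp only [Form.subst, ih₁, ih₂]
  | imp F G ih₁ ih₂ => simp only [Form.subst, ih₁, ih₂]
  | all F ih => simp only [Form.subst, ih, liftSubst_liftSubst]
  | ex F ih => simp only [Form.subst, ih, liftSubst_liftSubst]

theorem Form.subst_var (F : Form L) : F.subst Term.var = F := by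
  induction F with
  | eq t u => simp only [Form.subst, term_subst_var]
  | atom a => simp only [Form.subst, Atom.subst, term_subst_var]
  | neg F ih => simp only [Form.subst, ih]
  | and F G ih₁ ih₂ => simp only [Form.subst, ih₁, ih₂]
  | or F G ih₁ ih₂ => simp only [Form.subst, ih₁, ih₂]
  | imp F G ih₁ ih₂ => simp only [Form.subst, ih₁, ih₂]
  | all F ih => simp only [Form.subst, ih, liftSubst_var]
  | ex F ih => simp only [Form.subst, ih, liftSubst_var]

theorem Form.inst_subst_liftSubst (F : Form L) (σ : ℕ → L.Term ℕ) (t : L.Term ℕ) :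
    (F.subst (liftSubst σ)).inst t = F.subst (push t σ) := by
  rw [Form.inst, Form.subst_subst]
  congr 1
  funext n
  cases n with
  | zero => rfl
  | succ n =>
    simp only [liftSubst, term_subst_relabel, push_succ]
    exact term_subst_var _

theorem Form.fv_finite (F : Form L) : F.fv.Finite := by
  have key : ∀ s : Set ℕ, s.Finite → {n | n + 1 ∈ s}.Finite := fun s hs =>
    hs.preimage (fun a _ b _ h => Nat.succ_injective h)
  induction F with
  | eq t u =>
    exact (t.varFinset ∪ u.varFinset).finite_toSet.subset fun n hn => by
      simpa [Form.fv] using hn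
  | atom a =>
    exact (Finset.univ.biUnion fun i => (a.args i).varFinset).finite_toSet.subset fun n hn => by
      simpa [Form.fv] using hn
  | neg F ih => exact ih
  | and F G ih₁ ih₂ => exact ih₁.union ih₂
  | or F G ih₁ ih₂ => exact ih₁.union ih₂
  | imp F G ih₁ ih₂ => exact ih₁.union ih₂
  | all F ih => exact key _ ih
  | ex F ih => exact key _ ih

theorem exists_bound_fv (Γ : Finset (Form L)) : ∃ b : ℕ, ∀ F ∈ Γ, ∀ n ∈ F.fv, n < b := by
  have h : (⋃ F ∈ Γ, F.fv).Finite := Γ.finite_toSet.biUnion fun F _ => F.fv_finite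
  obtain ⟨b, hb⟩ := h.bddAbove
  exact ⟨b + 1, fun F hF n hn => Nat.lt_succ_of_le (hb (Set.mem_biUnion hF hn))⟩

theorem exists_fresh (Γ Δ : Finset (Form L)) (F : Form L) :
    ∃ x : ℕ, Fresh x Γ ∧ Fresh x Δ ∧ x ∉ F.fv := by
  obtain ⟨b, hb⟩ := exists_bound_fv (insert F (Γ ∪ Δ))
  refine ⟨b, fun G hG h => ?_, fun G hG h => ?_, fun h => ?_⟩
  · exact lt_irrefl _ (hb G (by simp [hG]) b h)
  · exact lt_irrefl _ (hb G (by simp [hG]) b h)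
  · exact lt_irrefl _ (hb F (by simp) b h)

instance [Countable (Σ l, L.Functions l)] [Countable (Σ l, L.Relations l)] :
    Countable (Form L) := by
  have hA : Countable (Atom L ℕ) := by
    refine Function.Injective.countable
      (f := fun a : Atom L ℕ => (⟨a.pred, a.args⟩ : Σ P : PredSym L, (Fin P.1 → L.Term ℕ))) ?_
    rintro ⟨P, t⟩ ⟨Q, u⟩ h
    cases h
    rfl
  obtain ⟨e, he⟩ := exists_injective_nat (L.Term ℕ)
  obtain ⟨e', he'⟩ := exists_injective_nat (Atom L ℕ)
  let code : Form L → ℕ := fun F => Form.rec (motive := fun _ => ℕ)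
    (fun t u => Nat.pair 0 (Nat.pair (e t) (e u))) (fun a => Nat.pair 1 (e' a))
    (fun _ m => Nat.pair 2 m) (fun _ _ m n => Nat.pair 3 (Nat.pair m n))
    (fun _ _ m n => Nat.pair 4 (Nat.pair m n)) (fun _ _ m n => Nat.pair 5 (Nat.pair m n))
    (fun _ m => Nat.pair 6 m) (fun _ m => Nat.pair 7 m) F
  refine Function.Injective.countable (f := code) ?_
  intro F
  induction F with
  | eq t u =>
    rintro (_ | _ | _ | _ | _ | _ | _ | _) h <;>
      simp [code, Nat.pair_eq_pair, he.eq_iff] at h ⊢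
    exact h
  | atom a =>
    rintro (_ | _ | _ | _ | _ | _ | _ | _) h <;>
      simp [code, Nat.pair_eq_pair, he'.eq_iff] at h ⊢
    exact h
  | neg F ih =>
    rintro (_ | _ | G | _ | _ | _ | _ | _) h <;> simp [code, Nat.pair_eq_pair] at h ⊢
    exact ih h
  | and F F' ih ih' =>
    rintro (_ | _ | _ | _ | _ | _ | _ | _) h <;> simp [code, Nat.pair_eq_pair] at h ⊢
    exact ⟨ih h.1, ih' h.2⟩
  | or F F' ih ih' =>
    rintro (_ | _ | _ | _ | _ | _ | _ | _) h <;> simp [code, Nat.pair_eq_pair] at h ⊢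
    exact ⟨ih h.1, ih' h.2⟩
  | imp F F' ih ih' =>
    rintro (_ | _ | _ | _ | _ | _ | _ | _) h <;> simp [code, Nat.pair_eq_pair] at h ⊢
    exact ⟨ih h.1, ih' h.2⟩
  | all F ih =>
    rintro (_ | _ | G | _ | _ | _ | _ | _) h <;> simp [code, Nat.pair_eq_pair] at h ⊢
    exact ih h
  | ex F ih =>
    rintro (_ | _ | G | _ | _ | _ | _ | _) h <;> simp [code, Nat.pair_eq_pair] at h ⊢
    exact ih h

end Subst

/-! ### Completeness: saturated theories and term models -/

namespace IndDefSystem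

variable {S : IndDefSystem}

/-- A set of formulas that is the set of truths of a term model: it is closed under all provable
sequents (in the classical multiple-conclusion sense), and variables witness the truth of
existential formulas and the falsity of universal ones. -/
structure IsSaturated (S : IndDefSystem) (T : Set (Form S.L)) : Prop where
  closed : ∀ Γ Δ, S.Provable Γ Δ → (∀ F ∈ Γ, F ∈ T) → ∃ F ∈ Δ, F ∈ T
  witness_ex : ∀ F : Form S.L, .ex F ∈ T → ∃ x, F.inst (Term.var x) ∈ T
  witness_all : ∀ F : Form S.L, .all F ∉ T → ∃ x, F.inst (Term.var x) ∉ T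

/-- One stage of the saturation: an unprovable sequent stays unprovable after a suitable decision
of the formula `G`, together with a fresh witness if one is called for. -/
theorem exists_decide {Γ Δ : Finset (Form S.L)} (h : ¬ S.Provable Γ Δ) (G : Form S.L) :
    ∃ Γ' Δ' : Finset (Form S.L), Γ ⊆ Γ' ∧ Δ ⊆ Δ' ∧ ¬ S.Provable Γ' Δ' ∧
      ((G ∈ Γ' ∧ ∀ F, G = .ex F → ∃ x, F.inst (Term.var x) ∈ Γ') ∨
        (G ∈ Δ' ∧ ∀ F, G = .all F → ∃ x, F.inst (Term.var x) ∈ Δ')) := by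
  by_cases hG : S.Provable (insert G Γ) Δ
  · have hΔ : ¬ S.Provable Γ (insert G Δ) := fun h' => h (.cut G h' hG)
    by_cases hall : ∃ F, G = .all F
    · obtain ⟨F, rfl⟩ := hall
      obtain ⟨x, hx₁, hx₂, hx₃⟩ := exists_fresh Γ (insert (.all F) Δ) (.all F)
      refine ⟨Γ, insert (F.inst (Term.var x)) (insert (.all F) Δ), subset_rfl,
        (Finset.subset_insert _ _).trans (Finset.subset_insert _ _), fun h' => hΔ ?_,
        Or.inr ⟨by simp, ?_⟩⟩
      · simpa using Provable.allR x hx₁ hx₂ hx₃ h'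
      · rintro _ ⟨rfl⟩
        exact ⟨x, by simp⟩
    · exact ⟨Γ, insert G Δ, subset_rfl, Finset.subset_insert _ _, hΔ,
        Or.inr ⟨by simp, fun F hF => absurd ⟨F, hF⟩ hall⟩⟩
  · by_cases hex : ∃ F, G = .ex F
    · obtain ⟨F, rfl⟩ := hex
      obtain ⟨x, hx₁, hx₂, hx₃⟩ := exists_fresh (insert (.ex F) Γ) Δ (.ex F)
      refine ⟨insert (F.inst (Term.var x)) (insert (.ex F) Γ), Δ,
        (Finset.subset_insert _ _).trans (Finset.subset_insert _ _), subset_rfl, fun h' => hG ?_,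
        Or.inl ⟨by simp, ?_⟩⟩
      · simpa using Provable.exL x hx₁ hx₂ hx₃ h'
      · rintro _ ⟨rfl⟩
        exact ⟨x, by simp⟩
    · exact ⟨insert G Γ, Δ, Finset.subset_insert _ _, subset_rfl, hG,
        Or.inl ⟨by simp, fun F hF => absurd ⟨F, hF⟩ hex⟩⟩

theorem exists_isSaturated [Countable (Form S.L)] {Γ Δ : Finset (Form S.L)}
    (h : ¬ S.Provable Γ Δ) :
    ∃ T : Set (Form S.L), S.IsSaturated T ∧ (∀ F ∈ Γ, F ∈ T) ∧ ∀ F ∈ Δ, F ∉ T := by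
  have : Nonempty (Form S.L) := ⟨.eq (Term.var 0) (Term.var 0)⟩
  obtain ⟨e, he⟩ := exists_surjective_nat (Form S.L)
  let C := {q : Finset (Form S.L) × Finset (Form S.L) // ¬ S.Provable q.1 q.2}
  have hstep : ∀ (G : Form S.L) (q : C), ∃ q' : C, q.1.1 ⊆ q'.1.1 ∧ q.1.2 ⊆ q'.1.2 ∧
      ((G ∈ q'.1.1 ∧ ∀ F, G = .ex F → ∃ x, F.inst (Term.var x) ∈ q'.1.1) ∨
        (G ∈ q'.1.2 ∧ ∀ F, G = .all F → ∃ x, F.inst (Term.var x) ∈ q'.1.2)) := by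
    intro G q
    obtain ⟨Γ', Δ', h₁, h₂, h₃, h₄⟩ := exists_decide q.2 G
    exact ⟨⟨(Γ', Δ'), h₃⟩, h₁, h₂, h₄⟩
  choose f hf₁ hf₂ hf₃ using hstep
  let c : ℕ → C := fun n => Nat.rec ⟨(Γ, Δ), h⟩ (fun n q => f (e n) q) n
  have hc : ∀ n, c (n + 1) = f (e n) (c n) := fun n => rfl
  have mono₁ : Monotone fun n => (c n).1.1 := monotone_nat_of_le_succ fun n => by
    rw [hc]; exact hf₁ _ _
  have mono₂ : Monotone fun n => (c n).1.2 := monotone_nat_of_le_succ fun n => by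
    rw [hc]; exact hf₂ _ _
  have disj : ∀ F m n, F ∈ (c m).1.1 → F ∈ (c n).1.2 → False := fun F m n h₁ h₂ =>
    (c (max m n)).2 (.ax ⟨F, Finset.mem_inter.2
      ⟨mono₁ (le_max_left m n) h₁, mono₂ (le_max_right m n) h₂⟩⟩)
  have decided : ∀ F, (∃ n, F ∈ (c n).1.1) ∨ ∃ n, F ∈ (c n).1.2 := by
    intro F
    obtain ⟨n, rfl⟩ := he F
    rcases hf₃ (e n) (c n) with h' | h'
    · exact Or.inl ⟨n + 1, h'.1⟩
    · exact Or.inr ⟨n + 1, h'.1⟩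
  have stage : ∀ (X : Finset (Form S.L)) (g : ℕ → Finset (Form S.L)), Monotone g →
      (∀ F ∈ X, ∃ n, F ∈ g n) → ∃ n, X ⊆ g n := by
    intro X g hg hX
    choose! k hk using hX
    exact ⟨X.sup k, fun F hF => hg (Finset.le_sup hF) (hk F hF)⟩
  refine ⟨{F | ∃ n, F ∈ (c n).1.1}, ⟨?_, ?_, ?_⟩, fun F hF => ⟨0, hF⟩,
    fun F hF ⟨n, hn⟩ => disj F n 0 hn hF⟩
  · intro Γ' Δ' hp hΓ
    by_contra hΔ
    push Not at hΔ
    obtain ⟨m, hm⟩ := stage Γ' _ mono₁ hΓ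
    obtain ⟨n, hn⟩ := stage Δ' _ mono₂ fun F hF => (decided F).resolve_left (hΔ F hF)
    exact (c (max m n)).2 (.wk (hm.trans (mono₁ (le_max_left m n)))
      (hn.trans (mono₂ (le_max_right m n))) hp)
  · rintro F ⟨m, hm⟩
    obtain ⟨n, hn⟩ := he (.ex F)
    rcases hf₃ (e n) (c n) with h' | h'
    · obtain ⟨x, hx⟩ := h'.2 F hn
      exact ⟨x, n + 1, hx⟩
    · exact (disj _ m (n + 1) (hn ▸ hm) h'.1).elim
  · intro F hF
    obtain ⟨n, hn⟩ := he (.all F)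
    rcases hf₃ (e n) (c n) with h' | h'
    · exact absurd ⟨n + 1, hn ▸ h'.1⟩ hF
    · obtain ⟨x, hx⟩ := h'.2 F hn
      exact ⟨x, fun ⟨m, hm⟩ => disj _ m (n + 1) hm hx⟩

/-- Leibniz's law: the rule for equality, whose two variables are first made fresh by shifting all
variables by two. -/
theorem provable_replace (G : Form S.L) (σ : ℕ → S.L.Term ℕ) (x : ℕ) (t u : S.L.Term ℕ) :
    S.Provable {.eq t u, G.subst (Function.update σ x t)} {G.subst (Function.update σ x u)} := by
  let up : S.L.Term ℕ → S.L.Term ℕ := fun t => t.relabel (· + 2)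
  have hup : ∀ (r s t : S.L.Term ℕ), (up t).subst (subst2 0 1 r s) = up t := by
    intro r s t
    simp only [up, term_subst_relabel]
    have : (fun n => subst2 0 1 r s (n + 2)) = fun n => (Term.var (n + 2) : S.L.Term ℕ) := by
      funext n
      simp [subst2]
    rw [this]
    induction t with
    | var n => rfl
    | func f ts ih => simp only [Term.relabel, Term.subst, ih]
  have hdown : ∀ t : S.L.Term ℕ, (up t).subst (fun n => Term.var (n - 2)) = t := by
    intro t
    simp only [up, term_subst_relabel, Nat.add_sub_cancel, term_subst_var]
  have h₁ : ∀ r s : S.L.Term ℕ, (fun n =>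
      (Function.update (fun k => up (σ k)) x (Term.var 0) n).subst
      (subst2 0 1 r s)) = Function.update (fun k => up (σ k)) x r := by
    intro r s
    funext n
    by_cases hn : n = x
    · subst hn; simp [subst2, Term.subst]
    · simp [Function.update_of_ne hn, hup]
  have h₂ : ∀ q r s : S.L.Term ℕ, (fun n =>
      (Function.update (fun k => up (σ k)) x (up q) n).subst
      (subst2 0 1 r s)) = Function.update (fun k => up (σ k)) x (up q) := by
    intro q r s
    funext n
    by_cases hn : n = x
    · subst hn; simp [hup]
    · simp [Function.update_of_ne hn, hup]
  have h₃ : ∀ r : S.L.Term ℕ, (fun n => (Function.update (fun k => up (σ k)) x (up r) n).subst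
      (fun n => Term.var (n - 2))) = Function.update σ x r := by
    intro r
    funext n
    by_cases hn : n = x
    · subst hn; simp [hdown]
    · simp [Function.update_of_ne hn, hdown]
  have key := Provable.eqL (S := S)
    (Γ := {G.subst (Function.update (fun k => up (σ k)) x (Term.var 0))})
    (Δ := {G.subst (Function.update (fun k => up (σ k)) x (up u))}) 0 1 (by decide) (up t) (up u)
    (.ax ⟨G.subst (Function.update (fun k => up (σ k)) x (up u)), by
      simp [substAll, Form.subst_subst, h₁, h₂]⟩)
  have := Provable.subst (fun n => Term.var (n - 2)) key
  simpa [substAll, Form.subst_subst, h₁, h₂, h₃, Form.subst, hdown] using this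

namespace IsSaturated

variable {T : Set (Form S.L)} (hT : S.IsSaturated T)

include hT

theorem neg_mem (F : Form S.L) : .neg F ∈ T ↔ F ∉ T := by
  constructor
  · intro h hF
    obtain ⟨G, hG, -⟩ := hT.closed {.neg F, F} ∅
      (.negL (.ax ⟨F, by simp⟩)) (by simp [h, hF])
    simp at hG
  · intro hF
    obtain ⟨G, hG, h⟩ := hT.closed ∅ {.neg F, F} (.negR (.ax ⟨F, by simp⟩)) (by simp)
    simp only [Finset.mem_insert, Finset.mem_singleton] at hG
    rcases hG with rfl | rfl
    · exact h
    · exact absurd h hF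

theorem mem_of_provable {Γ : Finset (Form S.L)} {F : Form S.L} (h : S.Provable Γ {F})
    (hΓ : ∀ G ∈ Γ, G ∈ T) : F ∈ T := by
  obtain ⟨G, hG, h⟩ := hT.closed _ _ h hΓ
  rw [Finset.mem_singleton] at hG
  exact hG ▸ h

theorem and_mem (F G : Form S.L) : .and F G ∈ T ↔ F ∈ T ∧ G ∈ T := by
  refine ⟨fun h => ⟨?_, ?_⟩, fun h => ?_⟩
  · exact hT.mem_of_provable (Γ := {.and F G}) (.andL (Γ := ∅) (.ax ⟨F, by simp⟩)) (by simp [h])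
  · exact hT.mem_of_provable (Γ := {.and F G}) (.andL (Γ := ∅) (.ax ⟨G, by simp⟩)) (by simp [h])
  · exact hT.mem_of_provable (Γ := {F, G})
      (.andR (Δ := ∅) (.ax ⟨F, by simp⟩) (.ax ⟨G, by simp⟩)) (by simp [h])

theorem or_mem (F G : Form S.L) : .or F G ∈ T ↔ F ∈ T ∨ G ∈ T := by
  refine ⟨fun h => ?_, fun h => ?_⟩
  · obtain ⟨H, hH, h'⟩ := hT.closed {.or F G} {F, G}
      (.orL (Γ := ∅) (.ax ⟨F, by simp⟩) (.ax ⟨G, by simp⟩)) (by simp [h])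
    simp only [Finset.mem_insert, Finset.mem_singleton] at hH
    rcases hH with rfl | rfl
    · exact Or.inl h'
    · exact Or.inr h'
  · rcases h with h | h
    · exact hT.mem_of_provable (Γ := {F}) (.orR (Δ := ∅) (.ax ⟨F, by simp⟩)) (by simp [h])
    · exact hT.mem_of_provable (Γ := {G}) (.orR (Δ := ∅) (.ax ⟨G, by simp⟩)) (by simp [h])

theorem imp_mem (F G : Form S.L) : .imp F G ∈ T ↔ (F ∈ T → G ∈ T) := by
  refine ⟨fun h hF => ?_, fun h => ?_⟩
  · exact hT.mem_of_provable (Γ := {.imp F G, F})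
      (.impL (.ax ⟨F, by simp⟩) (.ax ⟨G, by simp⟩)) (by simp [h, hF])
  · by_cases hF : F ∈ T
    · exact hT.mem_of_provable (Γ := {G}) (.impR (Δ := ∅) (.ax ⟨G, by simp⟩)) (by simp [h hF])
    · obtain ⟨H, hH, h'⟩ := hT.closed ∅ {.imp F G, F} (.impR (.ax ⟨F, by simp⟩)) (by simp)
      simp only [Finset.mem_insert, Finset.mem_singleton] at hH
      rcases hH with rfl | rfl
      · exact h'
      · exact absurd h' hF

theorem all_mem (F : Form S.L) : .all F ∈ T ↔ ∀ t, F.inst t ∈ T := by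
  refine ⟨fun h t => ?_, fun h => ?_⟩
  · exact hT.mem_of_provable (Γ := {.all F}) (.allL (Γ := ∅) t (.ax ⟨F.inst t, by simp⟩))
      (by simp [h])
  · by_contra hF
    obtain ⟨x, hx⟩ := hT.witness_all F hF
    exact hx (h _)

theorem ex_mem (F : Form S.L) : .ex F ∈ T ↔ ∃ t, F.inst t ∈ T := by
  refine ⟨fun h => ?_, fun ⟨t, h⟩ => ?_⟩
  · obtain ⟨x, hx⟩ := hT.witness_ex F h
    exact ⟨_, hx⟩
  · exact hT.mem_of_provable (Γ := {F.inst t}) (.exR (Δ := ∅) t (.ax ⟨F.inst t, by simp⟩))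
      (by simp [h])

theorem eq_refl_mem (t : S.L.Term ℕ) : .eq t t ∈ T :=
  hT.mem_of_provable (Γ := ∅) (.eqR (Δ := ∅) t) (by simp)

/-- Provably equal terms may be exchanged in finitely many places at once. -/
theorem replace_mem (G : Form S.L) (k : ℕ) (σ τ : ℕ → S.L.Term ℕ)
    (hlt : ∀ n < k, .eq (σ n) (τ n) ∈ T) (hge : ∀ n, k ≤ n → σ n = τ n)
    (h : G.subst σ ∈ T) : G.subst τ ∈ T := by
  have key : ∀ m ≤ k, G.subst (fun n => if n < m then τ n else σ n) ∈ T := by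
    intro m
    induction m with
    | zero => simpa using h
    | succ m ih =>
      intro hm
      have h₁ := hT.mem_of_provable (provable_replace G (fun n => if n < m then τ n else σ n) m
        (σ m) (τ m))
      have e₁ : Function.update (fun n => if n < m then τ n else σ n) m (σ m) =
          fun n => if n < m then τ n else σ n := by
        rw [Function.update_eq_self_iff]; simp
      have e₂ : Function.update (fun n => if n < m then τ n else σ n) m (τ m) =
          fun n => if n < m + 1 then τ n else σ n := by
        funext n
        rcases lt_trichotomy n m with hn | rfl | hn
        · rw [Function.update_of_ne hn.ne, if_pos hn, if_pos (by omega)]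
        · simp
        · rw [Function.update_of_ne hn.ne', if_neg (by omega), if_neg (by omega)]
      rw [e₁, e₂] at h₁
      exact h₁ (by simp [hlt m hm, ih (by omega)])
  have e : (fun n => if n < k then τ n else σ n) = τ := by
    funext n
    split_ifs with hn
    · rfl
    · exact hge n (by omega)
  exact e ▸ key k le_rfl

/-- Exchange of equal tuples that are substituted for the first `k` variables, while the remaining
variables are shifted down. -/
theorem replace_tuple_mem (G : Form S.L) {k : ℕ} (t u : Fin k → S.L.Term ℕ)
    (h : ∀ i, .eq (t i) (u i) ∈ T)
    (hG : G.subst (fun n => if hn : n < k then t ⟨n, hn⟩ else Term.var (n - k)) ∈ T) :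
    G.subst (fun n => if hn : n < k then u ⟨n, hn⟩ else Term.var (n - k)) ∈ T := by
  refine hT.replace_mem G k _ _ (fun n hn => ?_) (fun n hn => ?_) hG
  · simpa [hn] using h ⟨n, hn⟩
  · rw [dif_neg (by omega), dif_neg (by omega)]

theorem rel_mem (P : PredSym S.L) (t u : Fin P.1 → S.L.Term ℕ) (h : ∀ i, .eq (t i) (u i) ∈ T)
    (ht : .atom ⟨P, t⟩ ∈ T) : .atom ⟨P, u⟩ ∈ T := by
  have := hT.replace_tuple_mem (.atom ⟨P, fun i => Term.var i⟩) t u h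
  simp only [Form.subst, Atom.subst, Term.subst, Fin.is_lt, dite_true, Fin.eta] at this
  exact this ht

theorem func_mem {k : ℕ} (f : S.L.Functions k) (t u : Fin k → S.L.Term ℕ)
    (h : ∀ i, .eq (t i) (u i) ∈ T) : .eq (Term.func f t) (Term.func f u) ∈ T := by
  have := hT.replace_tuple_mem
    (.eq (Term.func f fun i => (t i).relabel (· + k)) (Term.func f fun i => Term.var i)) t u h
  simp only [Form.subst, Term.subst, Fin.is_lt, dite_true, Fin.eta, term_subst_relabel,
    Nat.add_lt_iff_lt_sub_right, Nat.sub_self, Nat.not_lt_zero, dite_false, Nat.add_sub_cancel,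
    term_subst_var] at this
  exact this (hT.eq_refl_mem _)

theorem eq_symm_mem (t u : S.L.Term ℕ) (h : .eq t u ∈ T) : .eq u t ∈ T := by
  have := hT.mem_of_provable (provable_replace
    (.eq (Term.var 0) (Term.var 1)) (fun _ => t) 0 t u)
  simp [Form.subst, Term.subst, h, hT.eq_refl_mem] at this
  exact this

theorem eq_trans_mem (s t u : S.L.Term ℕ) (h : .eq s t ∈ T) (h' : .eq t u ∈ T) : .eq s u ∈ T := by
  have := hT.mem_of_provable (provable_replace
    (.eq (Term.var 1) (Term.var 0)) (fun _ => s) 0 t u)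
  simp [Form.subst, Term.subst, h, h'] at this
  exact this

omit hT in
/-- Equality of terms according to a saturated theory. -/
def setoid (hT : S.IsSaturated T) : Setoid (S.L.Term ℕ) where
  r t u := .eq t u ∈ T
  iseqv := ⟨hT.eq_refl_mem, hT.eq_symm_mem _ _, hT.eq_trans_mem _ _ _⟩

omit hT in
/-- The universe of the term model: terms up to equality according to the theory. -/
def Univ (hT : S.IsSaturated T) : Type := Quotient hT.setoid

omit hT in
/-- The class of a term in the term model. -/
def cls (hT : S.IsSaturated T) (t : S.L.Term ℕ) : hT.Univ := Quotient.mk hT.setoid t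

theorem cls_eq (t u : S.L.Term ℕ) : hT.cls t = hT.cls u ↔ .eq t u ∈ T :=
  ⟨fun h => Quotient.exact (s := hT.setoid) h, fun h => Quotient.sound (s := hT.setoid) h⟩

theorem cls_surjective : Function.Surjective hT.cls := Quotient.mk_surjective

omit hT in
/-- The term model.  Symbols are interpreted through chosen representatives of the classes. -/
noncomputable instance termModel (hT : S.IsSaturated T) : S.L.Structure hT.Univ where
  funMap f v := hT.cls (Term.func f fun i => Function.surjInv hT.cls_surjective (v i))
  RelMap {k} R v := .atom ⟨⟨k, R⟩, fun i => Function.surjInv hT.cls_surjective (v i)⟩ ∈ T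

theorem eq_surjInv_mem (t : S.L.Term ℕ) :
    .eq (Function.surjInv hT.cls_surjective (hT.cls t)) t ∈ T :=
  (hT.cls_eq _ _).1 (Function.surjInv_eq hT.cls_surjective _)

theorem realize_cls (σ : ℕ → S.L.Term ℕ) (t : S.L.Term ℕ) :
    t.realize (fun n => hT.cls (σ n)) = hT.cls (t.subst σ) := by
  induction t with
  | var n => rfl
  | func f ts ih =>
    simp only [Term.realize, ih, Term.subst]
    exact (hT.cls_eq _ _).2 (hT.func_mem f _ _ fun i => hT.eq_surjInv_mem _)

/-- Truth in the term model is membership in the theory. -/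
theorem sat_cls (F : Form S.L) (σ : ℕ → S.L.Term ℕ) :
    F.Sat (fun n => hT.cls (σ n)) ↔ F.subst σ ∈ T := by
  have hpush : ∀ (t : S.L.Term ℕ) (σ : ℕ → S.L.Term ℕ),
      push (hT.cls t) (fun n => hT.cls (σ n)) = fun n => hT.cls (push t σ n) := by
    intro t σ
    funext n
    cases n <;> rfl
  induction F generalizing σ with
  | eq t u => simp only [Form.Sat, realize_cls, cls_eq, Form.subst]
  | atom a =>
    simp only [Form.Sat, Atom.Sat, realize_cls, Form.subst, Atom.subst]
    exact ⟨hT.rel_mem a.pred _ _ fun i => hT.eq_surjInv_mem _,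
      hT.rel_mem a.pred _ _ fun i => hT.eq_symm_mem _ _ (hT.eq_surjInv_mem _)⟩
  | neg F ih => simp only [Form.Sat, Form.subst, neg_mem hT, ih]
  | and F G ih₁ ih₂ => simp only [Form.Sat, Form.subst, and_mem hT, ih₁, ih₂]
  | or F G ih₁ ih₂ => simp only [Form.Sat, Form.subst, or_mem hT, ih₁, ih₂]
  | imp F G ih₁ ih₂ => simp only [Form.Sat, Form.subst, imp_mem hT, ih₁, ih₂]
  | all F ih =>
    simp only [Form.Sat, Form.subst, all_mem hT, hT.cls_surjective.forall, hpush, ih,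
      Form.inst_subst_liftSubst]
  | ex F ih =>
    simp only [Form.Sat, Form.subst, ex_mem hT, hT.cls_surjective.exists, hpush, ih,
      Form.inst_subst_liftSubst]

theorem valid_of_provable {Γ Δ : Finset (Form S.L)} (h : S.Provable Γ Δ) :
    Valid hT.Univ Γ Δ := by
  intro ρ hρ
  obtain ⟨σ, rfl⟩ : ∃ σ : ℕ → S.L.Term ℕ, ρ = fun n => hT.cls (σ n) :=
    ⟨fun n => Function.surjInv hT.cls_surjective (ρ n),
      funext fun n => (Function.surjInv_eq hT.cls_surjective _).symm⟩
  simp only [sat_cls] at hρ ⊢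
  simpa [substAll] using hT.closed _ _ (h.subst σ) (by simpa [substAll] using hρ)

end IsSaturated

/-- Completeness: an unprovable sequent is refuted in some structure in which all provable sequents
are valid. -/
theorem exists_countermodel [Countable (Form S.L)] {Γ Δ : Finset (Form S.L)}
    (h : ¬ S.Provable Γ Δ) :
    ∃ (M : Type) (_ : S.L.Structure M), (∀ Γ' Δ', S.Provable Γ' Δ' → Valid M Γ' Δ') ∧
      ¬ Valid M Γ Δ := by
  obtain ⟨T, hT, hΓ, hΔ⟩ := exists_isSaturated h
  refine ⟨hT.Univ, hT.termModel, fun _ _ => hT.valid_of_provable, fun hv => ?_⟩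
  obtain ⟨F, hF, h⟩ := hv (fun n => hT.cls (Term.var n)) (by
    intro F hF
    rw [hT.sat_cls, Form.subst_var]
    exact hΓ F hF)
  rw [hT.sat_cls, Form.subst_var] at h
  exact hΔ F hF h

end IndDefSystem

/-! ### Structures validating all provable sequents are Henkin models -/

section Blocks

variable {L : FirstOrder.Language.{0, 0}}

/-- The substitution that instantiates a block of `k` universal quantifiers by the terms `t`. -/
def instBlock (k : ℕ) (t : Fin k → L.Term ℕ) (n : ℕ) : L.Term ℕ :=
  if h : n < k then t ⟨n, h⟩ else Term.var (n - k)

theorem push_instBlock (k : ℕ) (t : Fin (k + 1) → L.Term ℕ) :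
    push (t 0) (instBlock k fun i => t i.succ) = instBlock (k + 1) t := by
  funext n
  cases n with
  | zero => simp [instBlock]
  | succ n => simp [instBlock]

theorem sat_all_iterate {M : Type} [L.Structure M] (k : ℕ) (G : Form L) (ρ : ℕ → M)
    (h : ∀ v : Fin k → M, G.Sat (fun n => if hn : n < k then v ⟨n, hn⟩ else ρ (n - k))) :
    (Form.all^[k] G).Sat ρ := by
  induction k generalizing G with
  | zero => simpa using h Fin.elim0
  | succ k ih =>
    rw [Function.iterate_succ_apply]
    refine ih _ fun v a => ?_
    have e : push a (fun n => if hn : n < k then v ⟨n, hn⟩ else ρ (n - k)) =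
        fun n => if hn : n < k + 1 then (Fin.cons a v : Fin (k + 1) → M) ⟨n, hn⟩
          else ρ (n - (k + 1)) := by
      funext n
      cases n with
      | zero => simp
      | succ n =>
        simp only [push_succ, Nat.add_lt_add_iff_right, Nat.add_sub_add_right]
        split_ifs
        · rfl
        · rfl
    rw [e]
    exact h _

/-- The implication with antecedents `l` and consequent `C`. -/
def imps (l : List (Form L)) (C : Form L) : Form L := l.foldr .imp C

theorem subst_imps (l : List (Form L)) (C : Form L) (σ : ℕ → L.Term ℕ) :
    (imps l C).subst σ = imps (l.map fun A => A.subst σ) (C.subst σ) := by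
  induction l with
  | nil => rfl
  | cons A l ih => exact congrArg _ ih

theorem sat_imps {M : Type} [L.Structure M] (l : List (Form L)) (C : Form L) (ρ : ℕ → M) :
    (imps l C).Sat ρ ↔ ((∀ A ∈ l, A.Sat ρ) → C.Sat ρ) := by
  induction l with
  | nil => simp [imps]
  | cons A l ih =>
    rw [List.forall_mem_cons, and_imp, ← ih]
    rfl

end Blocks

namespace IndDefSystem

variable {S : IndDefSystem}

theorem Provable.all_iterate_left {Γ Δ : Finset (Form S.L)} (k : ℕ) (G : Form S.L)
    (t : Fin k → S.L.Term ℕ) (h : S.Provable (insert (G.subst (instBlock k t)) Γ) Δ) :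
    S.Provable (insert (Form.all^[k] G) Γ) Δ := by
  induction k generalizing G with
  | zero =>
    have e : instBlock 0 t = Term.var := by
      funext n
      simp [instBlock]
    rwa [e, Form.subst_var] at h
  | succ k ih =>
    rw [Function.iterate_succ_apply]
    refine ih _ (fun i => t i.succ) (.allL (t 0) ?_)
    rwa [Form.inst_subst_liftSubst, push_instBlock]

theorem Provable.imps_left {Γ Δ : Finset (Form S.L)} (l : List (Form S.L)) (C : Form S.L)
    (hl : ∀ A ∈ l, A ∈ Γ) (hC : C ∈ Δ) : S.Provable (insert (imps l C) Γ) Δ := by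
  induction l with
  | nil => exact .ax ⟨C, by simp [imps, hC]⟩
  | cons A l ih =>
    rw [List.forall_mem_cons] at hl
    exact .impL (.ax ⟨A, by simp [hl.1]⟩) (ih hl.2)

open Classical in
/-- The induction hypothesis attached to an atom of a production with `k` variables, where these
are the innermost de Bruijn indices. -/
noncomputable def blockHyp (S : IndDefSystem) (P : PredSym S.L)
    (z : ∀ Q : PredSym S.L, Fin Q.1 → ℕ) (F : PredSym S.L → Form S.L) {k : ℕ}
    (a : Atom S.L (Fin k)) : Form S.L :=
  if S.MutDep a.pred P then
    (F a.pred).subst (Function.extend (z a.pred) (fun i => (a.args i).relabel Fin.val)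
      fun n => Term.var (n + k))
  else .atom ⟨a.pred, fun i => (a.args i).relabel Fin.val⟩

theorem relabel_subst_instBlock {L : FirstOrder.Language.{0, 0}} {k : ℕ} (s : L.Term (Fin k))
    (t : Fin k → L.Term ℕ) : (s.relabel Fin.val).subst (instBlock k t) = s.subst t := by
  rw [term_subst_relabel]
  congr 1
  funext i
  simp [instBlock]

theorem blockHyp_subst (P : PredSym S.L) (z : ∀ Q : PredSym S.L, Fin Q.1 → ℕ)
    (hz : ∀ Q, Function.Injective (z Q)) (F : PredSym S.L → Form S.L) {k : ℕ}
    (a : Atom S.L (Fin k)) (t : Fin k → S.L.Term ℕ) :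
    (S.blockHyp P z F a).subst (instBlock k t) = S.indHyp P z F (a.subst t) := by
  have e : (a.subst t).pred = a.pred := rfl
  rw [blockHyp, indHyp, e]
  split_ifs with hd
  · rw [hypAt, Form.substVec, Form.subst_subst]
    refine congrArg (F a.pred).subst ?_
    funext n
    change _ = Function.extend (z a.pred) (fun i => (a.args i).subst t) Term.var n
    by_cases h : ∃ i, z a.pred i = n
    · obtain ⟨i, rfl⟩ := h
      rw [(hz _).extend_apply, (hz _).extend_apply, relabel_subst_instBlock]
    · rw [Function.extend_apply' _ _ _ h, Function.extend_apply' _ _ _ h]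
      simp [instBlock, Term.subst]
  · simp only [Form.subst, Atom.subst, relabel_subst_instBlock]

/-- The universal closure of the minor premise of the induction rule for a production. -/
noncomputable def minorClosure (S : IndDefSystem) (P : PredSym S.L)
    (z : ∀ Q : PredSym S.L, Fin Q.1 → ℕ) (F : PredSym S.L → Form S.L) (π : Production S.L) :
    Form S.L :=
  Form.all^[π.nvars] (imps (π.premises.map (S.blockHyp P z F)) (S.blockHyp P z F π.concl))

theorem MutDep.mem_ind {P Q : PredSym S.L} (h : S.MutDep Q P) (hP : P ∈ S.ind) : Q ∈ S.ind := by
  rcases Relation.ReflTransGen.cases_head h.1 with rfl | ⟨R, hR, -⟩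
  · exact hP
  · exact hR.1

open Classical in
/-- The induction principle as a single sequent. -/
theorem provable_induction (P : PredSym S.L) (hP : P ∈ S.ind)
    (z : ∀ Q : PredSym S.L, Fin Q.1 → ℕ) (hz : ∀ Q, Function.Injective (z Q))
    (F : PredSym S.L → Form S.L) (u : Fin P.1 → S.L.Term ℕ) :
    S.Provable (insert (.atom ⟨P, u⟩)
      ((S.prods_finite.toFinset.filter fun π => S.MutDep π.concl.pred P).image
        (S.minorClosure P z F))) {hypAt z F ⟨P, u⟩} := by
  set Γ := (S.prods_finite.toFinset.filter fun π => S.MutDep π.concl.pred P).image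
        (S.minorClosure P z F) with hΓ
  obtain ⟨b, hb⟩ := exists_bound_fv
    (insert (hypAt z F ⟨P, u⟩) (Γ ∪ S.ind_finite.toFinset.image F))
  have hfresh : ∀ n, ∀ G ∈ insert (hypAt z F ⟨P, u⟩) (Γ ∪ S.ind_finite.toFinset.image F),
      b + n ∉ G.fv := fun n G hG h => by
    have := hb G hG _ h
    omega
  refine .ind P hP u z hz F (fun π i => b + i) (fun π i j h => Fin.ext (by simpa using h))
    (fun π i G hG => hfresh _ G (by simp [hG])) (fun π i G hG => hfresh _ G (by simp_all))
    (fun π i Q hQ => hfresh _ _ ?_) ?_ (.ax ⟨hypAt z F ⟨P, u⟩, by simp⟩)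
  · simp only [Finset.mem_insert, Finset.mem_union, Finset.mem_image, Set.Finite.mem_toFinset]
    exact Or.inr (Or.inr ⟨Q, hQ.mem_ind hP, rfl⟩)
  · intro π hπ hdep
    have hmem : S.minorClosure P z F π ∈ Γ := by
      simp only [hΓ, Finset.mem_image, Finset.mem_filter, Set.Finite.mem_toFinset]
      exact ⟨π, ⟨hπ, hdep⟩, rfl⟩
    rw [← Finset.insert_eq_of_mem (Finset.mem_union_left _ hmem)]
    refine Provable.all_iterate_left _ _ (fun i => Term.var (b + i)) ?_
    rw [subst_imps]
    refine Provable.imps_left _ _ ?_ ?_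
    · intro A hA
      simp only [List.map_map, List.mem_map, Function.comp] at hA
      obtain ⟨a, ha, rfl⟩ := hA
      rw [blockHyp_subst P z hz]
      simp only [Finset.mem_union, List.mem_toFinset, List.mem_map]
      exact Or.inr ⟨a, ha, rfl⟩
    · rw [blockHyp_subst P z hz, indHyp, if_pos (by exact hdep)]
      exact Finset.mem_insert_self _ _

theorem isHenkinModel_of_valid {M : Type} [Nonempty M] [S.L.Structure M]
    (h : ∀ Γ Δ, S.Provable Γ Δ → Valid M Γ Δ) : S.IsHenkinModel M := by
  classical
  obtain ⟨c⟩ := ‹Nonempty M›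
  constructor
  · intro π hπ v hv
    have hp : S.Provable (π.premises.map fun a => .atom (a.subst fun i => Term.var i)).toFinset
        {.atom (π.concl.subst fun i => Term.var i)} :=
      .prodR (Δ := ∅) π hπ _ fun a ha => .ax ⟨.atom (a.subst fun i => Term.var i), by
        simp only [Finset.mem_inter, List.mem_toFinset, List.mem_map, Finset.mem_insert_self,
          and_true]
        exact ⟨a, ha, rfl⟩⟩
    have hval : (fun i : Fin π.nvars => (Term.var i : S.L.Term ℕ).realize
        (fun n => if hn : n < π.nvars then v ⟨n, hn⟩ else c)) = v := by
      funext i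
      simp
    obtain ⟨G, hG, hsat⟩ := h _ _ hp (fun n => if hn : n < π.nvars then v ⟨n, hn⟩ else c) (by
      intro G hG
      rw [List.mem_toFinset, List.mem_map] at hG
      obtain ⟨a, ha, rfl⟩ := hG
      refine (a.sat_subst _ _).2 ?_
      rw [hval]
      exact hv a ha)
    rw [Finset.mem_singleton] at hG
    subst hG
    have := (π.concl.sat_subst _ _).1 hsat
    rwa [hval] at this
  · intro P hP z hz F ρ hminor w hw
    set Γ := (S.prods_finite.toFinset.filter fun π => S.MutDep π.concl.pred P).image
        (S.minorClosure P z F) with hΓ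
    obtain ⟨b, hb⟩ := exists_bound_fv (insert (F P) Γ)
    -- The arguments `w` become the values of variables that occur nowhere else.
    set y : Fin P.1 → ℕ := fun i => b + i
    have hy : Function.Injective y := fun i j e => Fin.ext (by simpa [y] using e)
    have hval : (fun i => (Term.var (y i) : S.L.Term ℕ).realize (Function.extend y w ρ)) = w :=
      funext fun i => hy.extend_apply w ρ i
    have hcongr : ∀ G ∈ insert (F P) Γ, ∀ n ∈ G.fv, Function.extend y w ρ n = ρ n := by
      intro G hG n hn
      refine Function.extend_apply' _ _ _ ?_
      rintro ⟨i, rfl⟩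
      have := hb G hG _ hn
      simp only [y] at this
      omega
    obtain ⟨G, hG, hsat⟩ := h _ _ (provable_induction P hP z hz F fun i => Term.var (y i))
      (Function.extend y w ρ) (by
        rw [Finset.forall_mem_insert]
        refine ⟨?_, fun G hG => ?_⟩
        · simp only [Form.Sat, Atom.Sat, hval]
          exact hw
        rw [G.sat_congr (hcongr G (Finset.mem_insert_of_mem hG))]
        simp only [Finset.mem_image, Finset.mem_filter, Set.Finite.mem_toFinset] at hG
        obtain ⟨π, ⟨hπ, hdep⟩, rfl⟩ := hG
        refine sat_all_iterate _ _ _ fun v => ?_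
        have hrel : ∀ s : S.L.Term (Fin π.nvars), (s.relabel Fin.val).realize
            (fun n => if hn : n < π.nvars then v ⟨n, hn⟩ else ρ (n - π.nvars)) = s.realize v := by
          intro s
          rw [Term.realize_relabel]
          congr 1
          funext i
          simp
        have hblock : ∀ a : Atom S.L (Fin π.nvars), (S.blockHyp P z F a).Sat
            (fun n => if hn : n < π.nvars then v ⟨n, hn⟩ else ρ (n - π.nvars)) ↔
            if S.MutDep a.pred P then
              (F a.pred).Sat (Function.extend (z a.pred) (fun i => (a.args i).realize v) ρ)
            else a.Sat v := by
          intro a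
          rw [blockHyp]
          split_ifs with hd
          · rw [Form.sat_subst]
            apply iff_of_eq
            congr 1
            funext n
            by_cases hn : ∃ i, z a.pred i = n
            · obtain ⟨i, rfl⟩ := hn
              rw [(hz _).extend_apply, (hz _).extend_apply, hrel]
            · rw [Function.extend_apply' _ _ _ hn, Function.extend_apply' _ _ _ hn]
              simp
          · simp only [Form.Sat, Atom.Sat, hrel]
        rw [sat_imps, hblock, if_pos hdep]
        intro hprem
        refine hminor π hπ hdep v fun a ha => (hblock a).1 (hprem _ (List.mem_map_of_mem ha)))
    rw [Finset.mem_singleton] at hG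
    subst hG
    rw [sat_hypAt z hz] at hsat
    simp only [hval] at hsat
    refine ((F P).sat_congr fun n hn => ?_).1 hsat
    by_cases hz' : ∃ i, z P i = n
    · obtain ⟨i, rfl⟩ := hz'
      rw [(hz _).extend_apply, (hz _).extend_apply]
    · rw [Function.extend_apply' _ _ _ hz', Function.extend_apply' _ _ _ hz']
      exact hcongr (F P) (Finset.mem_insert_self _ _) n hn

/-- Completeness of `LKID` for Henkin models. -/
theorem provable_of_valid [Countable (Form S.L)] {Γ Δ : Finset (Form S.L)}
    (h : ∀ (M : Type) [S.L.Structure M] [Nonempty M], S.IsHenkinModel M → Valid M Γ Δ) :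
    S.Provable Γ Δ := by
  by_contra hnot
  obtain ⟨M, _, hM, hv⟩ := exists_countermodel hnot
  have : Nonempty M := by
    by_contra hne
    exact hv fun ρ => absurd ⟨ρ 0⟩ hne
  exact hv (h M (isHenkinModel_of_valid hM))

end IndDefSystem

/-! ### Henkin models of the two systems -/

section NatStructure

variable (M : Type) [langN.Structure M]

/-- The value of `0`. -/
def zeroVal : M := Structure.funMap (show langN.Functions 0 from NFunc.zero) ![]

variable {M}

/-- The value of `s`. -/
def succVal (a : M) : M := Structure.funMap (show langN.Functions 1 from NFunc.succ) ![a]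

/-- The interpretation of `N`. -/
def NatVal (a : M) : Prop := Structure.RelMap (show langN.Relations 1 from NPred.nat) ![a]

/-- The interpretation of `p`. -/
def PVal (a b : M) : Prop := Structure.RelMap (show langN.Relations 2 from NPred.p) ![a, b]

theorem comp_vec_one {X Y : Type} (f : X → Y) (a : X) :
    (fun i => f ((![a] : Fin 1 → X) i)) = ![f a] := by
  funext i
  fin_cases i
  rfl

theorem comp_vec_two {X Y : Type} (f : X → Y) (a b : X) :
    (fun i => f ((![a, b] : Fin 2 → X) i)) = ![f a, f b] := by
  funext i
  fin_cases i <;> rfl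

@[simp] theorem realize_zero {α : Type} (v : α → M) : (zero : langN.Term α).realize v = zeroVal M :=
  congrArg (Structure.funMap _) (funext fun i => i.elim0)

@[simp] theorem realize_succ {α : Type} (t : langN.Term α) (v : α → M) :
    (succ t).realize v = succVal (t.realize v) :=
  congrArg (Structure.funMap _) (comp_vec_one (fun t : langN.Term α => t.realize v) t)

theorem realize_natAtom_args {α : Type} (t : langN.Term α) (v : α → M) :
    (fun i => ((natAtom t).args i).realize v) = ![t.realize v] :=
  comp_vec_one (fun t : langN.Term α => t.realize v) t

theorem sat_natAtom {α : Type} (t : langN.Term α) (v : α → M) :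
    (natAtom t).Sat v ↔ NatVal (t.realize v) :=
  iff_of_eq (congrArg (Structure.RelMap _) (realize_natAtom_args t v))

theorem sat_natAtom_zero {α : Type} (v : α → M) :
    (natAtom (zero : langN.Term α)).Sat v ↔ NatVal (zeroVal M) := by
  rw [sat_natAtom, realize_zero]

theorem sat_natAtom_succ {α : Type} (t : langN.Term α) (v : α → M) :
    (natAtom (succ t)).Sat v ↔ NatVal (succVal (t.realize v)) := by
  rw [sat_natAtom, realize_succ]

theorem extend_natAtom_args {α : Type} (z : Fin 1 → ℕ) (t : langN.Term α) (v : α → M)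
    (ρ : ℕ → M) : Function.extend z (fun i => ((natAtom t).args i).realize v) ρ =
      Function.extend z ![t.realize v] ρ :=
  congrArg (fun w => Function.extend z w ρ) (realize_natAtom_args t v)

theorem extend_natAtom_zero {α : Type} (z : Fin 1 → ℕ) (v : α → M) (ρ : ℕ → M) :
    Function.extend z (fun i => ((natAtom (zero : langN.Term α)).args i).realize v) ρ =
      Function.extend z ![zeroVal M] ρ := by
  rw [extend_natAtom_args, realize_zero]

theorem extend_natAtom_succ {α : Type} (z : Fin 1 → ℕ) (t : langN.Term α) (v : α → M)
    (ρ : ℕ → M) : Function.extend z (fun i => ((natAtom (succ t)).args i).realize v) ρ =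
      Function.extend z ![succVal (t.realize v)] ρ := by
  rw [extend_natAtom_args, realize_succ]

@[simp] theorem sat_nat (t : langN.Term ℕ) (ρ : ℕ → M) : (nat t).Sat ρ ↔ NatVal (t.realize ρ) :=
  sat_natAtom t ρ

@[simp] theorem sat_p (t u : langN.Term ℕ) (ρ : ℕ → M) :
    (p t u).Sat ρ ↔ PVal (t.realize ρ) (u.realize ρ) :=
  iff_of_eq (congrArg (Structure.RelMap _)
    (comp_vec_two (fun t : langN.Term ℕ => t.realize ρ) t u))

variable (M) in
/-- The hypotheses `H_a`, …, `H_d` of the 2-Hydra statement hold in `M`. -/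
structure HydraHyp : Prop where
  zero_zero : PVal (zeroVal M) (zeroVal M)
  one_zero : PVal (succVal (zeroVal M)) (zeroVal M)
  one_right : ∀ x : M, NatVal x → PVal x (succVal (zeroVal M))
  step : ∀ x y : M, NatVal x → NatVal y → PVal x y → PVal (succVal x) (succVal (succVal y))
  step_zero_left : ∀ y : M, NatVal y → PVal (succVal y) y → PVal (zeroVal M) (succVal (succVal y))
  step_zero_right : ∀ x : M, NatVal x → PVal (succVal x) x → PVal (succVal (succVal x)) (zeroVal M)

theorem sat_zeroAx (ρ : ℕ → M) :
    zeroAx.Sat ρ ↔ ∀ x : M, NatVal x → succVal x ≠ zeroVal M := by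
  simp [zeroAx, allN, Form.Sat]

theorem sat_succAx (ρ : ℕ → M) :
    succAx.Sat ρ ↔ ∀ x y : M, NatVal x → NatVal y → succVal x = succVal y → x = y := by
  simp [succAx, allN2, Form.Sat, push]

theorem sat_hydra (hN : NatVal (zeroVal M)) (ρ : ℕ → M) :
    hydra.Sat ρ ↔ (HydraHyp M → ∀ x y : M, NatVal x → NatVal y → PVal x y) := by
  simp only [hydra, hydraA, hydraB, hydraC, hydraD, allN, allN2, Form.Sat, sat_nat, sat_p,
    realize_zero, realize_succ, Term.realize_var, push, and_imp]
  constructor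
  · rintro h ⟨a₁, a₂, a₃, b, c, d⟩
    exact h (fun x hx => ⟨a₁, a₂, a₃ x hx⟩) b c d
  · intro h a b c d
    exact h ⟨(a _ hN).1, (a _ hN).2.1, fun x hx => (a x hx).2.2, b, c, d⟩

variable (M) in
/-- The interpretation of `N` contains `0`, is closed under `s`, and satisfies induction for
predicates definable with parameters. -/
structure IsNatModel : Prop where
  zero_mem : NatVal (zeroVal M)
  succ_mem : ∀ a : M, NatVal a → NatVal (succVal a)
  induction : ∀ (F : Form langN) (ρ : ℕ → M), F.Sat (push (zeroVal M) ρ) →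
    (∀ a, F.Sat (push a ρ) → F.Sat (push (succVal a) ρ)) → ∀ a, NatVal a → F.Sat (push a ρ)

end NatStructure

theorem IndDefSystem.mutDep_iff_eq {S : IndDefSystem} (h : ∀ P Q, S.IsPremise P Q → P = Q)
    (P Q : PredSym S.L) : S.MutDep P Q ↔ P = Q := by
  constructor
  · rintro ⟨hPQ, -⟩
    induction hPQ with
    | refl => rfl
    | tail _ h' ih => exact ih.trans (h _ _ h')
  · rintro rfl
    exact ⟨.refl, .refl⟩

theorem extend_one {X : Type} {z : Fin 1 → ℕ} (hz : Function.Injective z) (a : X) (ρ : ℕ → X) :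
    Function.extend z ![a] ρ = Function.update ρ (z 0) a := by
  funext n
  by_cases h : ∃ i, z i = n
  · obtain ⟨i, rfl⟩ := h
    rw [hz.extend_apply]
    fin_cases i
    simp
  · rw [Function.extend_apply' _ _ _ h, Function.update_of_ne]
    rintro rfl
    exact h ⟨0, rfl⟩

theorem sysN_isPremise (P Q : PredSym sysN.L) (h : sysN.IsPremise P Q) : P = Q := by
  obtain ⟨hP, hQ, -⟩ := h
  exact hP.trans hQ.symm

theorem IsNatModel.isHenkinModel {M : Type} [langN.Structure M] (hM : IsNatModel M) :
    sysN.IsHenkinModel M := by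
  have hdep := IndDefSystem.mutDep_iff_eq sysN_isPremise
  constructor
  · rintro π (rfl | rfl) v hv
    · exact (sat_natAtom_zero (α := Fin 0) v).2 hM.zero_mem
    · exact (sat_natAtom_succ (α := Fin 1) (Term.var 0) v).2 (hM.succ_mem _
        ((sat_natAtom (α := Fin 1) (Term.var 0) v).1 (hv _ (List.mem_singleton_self _))))
  · rintro P rfl z hz F ρ hminor w hw
    have hw' : w = ![w 0] := by
      funext i
      fin_cases i
      rfl
    have hz' := hz ⟨1, NPred.nat⟩
    set x := z ⟨1, NPred.nat⟩ 0 with hx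
    set G : Form langN := F ⟨1, NPred.nat⟩ with hG
    -- Renaming turns the induction variable `x` into the de Bruijn index `0`.
    have key : ∀ a : M, (G.subst fun n => if n = x then Term.var 0 else Term.var (n + 1)).Sat
        (push a ρ) ↔ G.Sat (Function.extend (z ⟨1, NPred.nat⟩) ![a] ρ) := by
      intro a
      rw [Form.sat_subst, extend_one hz']
      apply iff_of_eq
      congr 1
      funext n
      by_cases hn : n = x
      · subst hn
        simp [← hx]
      · rw [if_neg hn, Function.update_of_ne hn]
        rfl
    rw [hw']
    refine (key _).1 (hM.induction _ ρ ((key _).2 ?_) (fun a ha => (key _).2 ?_) _ ?_)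
    · have := hminor prodNZero (Or.inl rfl) ((hdep _ _).2 rfl) ![] (fun _ h => by cases h)
      exact (iff_of_eq (congrArg G.Sat (extend_natAtom_zero (α := Fin 0) _ _ _))).1 this
    · have := hminor prodNSucc (Or.inr rfl) ((hdep _ _).2 rfl) ![a] (by
        intro b hb
        rw [List.mem_singleton.1 hb]
        refine (iff_of_eq (if_pos ((hdep _ _).2 rfl))).2 ?_
        exact (iff_of_eq (congrArg G.Sat (extend_natAtom_args (α := Fin 1) _ (Term.var 0) _ _))).2
          ((key a).1 ha))
      exact (iff_of_eq (congrArg G.Sat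
        (extend_natAtom_succ (α := Fin 1) _ (Term.var 0) _ _))).1 this
    · rw [hw'] at hw
      exact hw

section LeStructure

variable {M : Type} [langNLe.Structure M]

/-- The interpretation of `≤`. -/
def LeVal (a b : M) : Prop := Structure.RelMap leSym.2 ![a, b]

theorem sat_leAtom {α : Type} (t u : langNLe.Term α) (v : α → M) :
    (leAtom t u).Sat v ↔ LeVal (t.realize v) (u.realize v) :=
  iff_of_eq (congrArg (Structure.RelMap _)
    (comp_vec_two (fun t : langNLe.Term α => t.realize v) t u))

theorem Atom.sat_map {L L' : FirstOrder.Language.{0, 0}} (φ : L →ᴸ L') {M α : Type}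
    [L.Structure M] [L'.Structure M] [φ.IsExpansionOn M] (a : Atom L α) (v : α → M) :
    (a.map φ).Sat v ↔ a.Sat v := by
  simp only [Atom.Sat, Atom.map, LHom.realize_onTerm]
  exact iff_of_eq (LHom.map_onRelation (M := M) φ a.pred.2 _)

theorem mapPred_ne_leSym (P : PredSym langN) : mapPred incl P ≠ leSym := by
  rintro h
  obtain ⟨k, P⟩ := P
  cases P <;> cases h

theorem sysNLe_isPremise (P Q : PredSym sysNLe.L) (h : sysNLe.IsPremise P Q) : P = Q := by
  obtain ⟨-, -, π, rfl | rfl | rfl | rfl, rfl, a, ha, rfl⟩ := h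
  · cases ha
  · rw [List.mem_singleton.1 ha]; rfl
  · cases ha
  · rw [List.mem_singleton.1 ha]; rfl

theorem extend_val_push {X : Type} {k : ℕ} (w : Fin k → X) (ρ : ℕ → X) :
    Function.extend (Fin.val : Fin k → ℕ) w ρ =
      fun n => if hn : n < k then w ⟨n, hn⟩ else ρ n := by
  funext n
  split_ifs with hn
  · exact Fin.val_injective.extend_apply w ρ ⟨n, hn⟩
  · exact Function.extend_apply' _ _ _ (by rintro ⟨i, rfl⟩; exact hn i.2)

theorem extend_val_one {X : Type} (a b : X) (ρ : ℕ → X) :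
    Function.extend (Fin.val : Fin 1 → ℕ) ![a] (push b ρ) = push a ρ := by
  rw [extend_val_push]
  funext n
  rcases n with _ | n
  · simp
  · simp

theorem extend_val_two {X : Type} (a b c d : X) (ρ : ℕ → X) :
    Function.extend (Fin.val : Fin 2 → ℕ) ![a, b] (push c (push d ρ)) = push a (push b ρ) := by
  rw [extend_val_push]
  funext n
  rcases n with _ | _ | n
  · simp
  · simp
  · simp

theorem extend_leAtom {α : Type} (t u : langNLe.Term α) (v : α → M) (a b : M) (ρ : ℕ → M) :
    Function.extend (Fin.val : Fin 2 → ℕ) (fun i => ((leAtom t u).args i).realize v)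
      (push a (push b ρ)) = push (t.realize v) (push (u.realize v) ρ) :=
  (congrArg (fun w => Function.extend (Fin.val : Fin 2 → ℕ) w (push a (push b ρ)))
    (comp_vec_two (fun t : langNLe.Term α => t.realize v) t u)).trans (extend_val_two _ _ _ _ _)

theorem leVal_refl (hM : sysNLe.IsHenkinModel M) (a : M) : LeVal a a :=
  (sat_leAtom (α := Fin 1) (Term.var 0) (Term.var 0) ![a]).1
    (hM.closed prodLeRefl (by simp) ![a] (fun _ h => by cases h))

variable [langN.Structure M] [incl.IsExpansionOn M]

@[simp] theorem realize_succLe {α : Type} (t : langNLe.Term α) (v : α → M) :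
    (succLe t).realize v = succVal (t.realize v) :=
  (congrArg (Structure.funMap _) (comp_vec_one (fun t : langNLe.Term α => t.realize v) t)).trans
    (LHom.map_onFunction incl (M := M) _ _)

theorem extend_natAtom_map {α : Type} (t : langN.Term α) (v : α → M) (a : M) (ρ : ℕ → M) :
    Function.extend (Fin.val : Fin 1 → ℕ) (fun i => (((natAtom t).map incl).args i).realize v)
      (push a ρ) = push (t.realize v) ρ := by
  have e : (fun i => ((((natAtom t).map incl).args i).realize v)) = ![t.realize v] :=
    (funext fun i => LHom.realize_onTerm incl ((natAtom t).args i) v).trans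
      (realize_natAtom_args t v)
  exact (congrArg (fun w => Function.extend (Fin.val : Fin 1 → ℕ) w (push a ρ)) e).trans
    (extend_val_one _ _ _)

variable (hM : sysNLe.IsHenkinModel M)
include hM

theorem leVal_succ {a b : M} (h : LeVal a b) : LeVal a (succVal b) := by
  have := (sat_leAtom (α := Fin 2) (Term.var 0) (succLe (Term.var 1)) ![a, b]).1
    (hM.closed prodLeSucc (by simp) ![a, b] (by
      intro c hc
      rw [List.mem_singleton.1 hc]
      exact (sat_leAtom (α := Fin 2) (Term.var 0) (Term.var 1) ![a, b]).2 h))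
  rwa [realize_succLe] at this

theorem leVal_induction (F : Form langNLe) (ρ : ℕ → M) (h₀ : ∀ a, F.Sat (push a (push a ρ)))
    (h₁ : ∀ a b, F.Sat (push a (push b ρ)) → F.Sat (push a (push (succVal b) ρ))) {a b : M}
    (h : LeVal a b) : F.Sat (push a (push b ρ)) := by
  have hdep := IndDefSystem.mutDep_iff_eq sysNLe_isPremise
  refine (iff_of_eq (congrArg F.Sat (extend_val_two a b a b ρ))).1
    (hM.induction leSym (by simp) (fun _ => Fin.val) (fun _ => Fin.val_injective)
    (fun _ => F) (push a (push b ρ)) ?_ ![a, b] h)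
  intro π hπ hπd v hv
  rw [hdep] at hπd
  rcases hπ with rfl | rfl | rfl | rfl
  · exact absurd hπd (mapPred_ne_leSym _)
  · exact absurd hπd (mapPred_ne_leSym _)
  · exact (iff_of_eq (congrArg F.Sat
      (extend_leAtom (α := Fin 1) (Term.var 0) (Term.var 0) v a b ρ))).2 (h₀ _)
  · refine (iff_of_eq (congrArg F.Sat
      (extend_leAtom (α := Fin 2) (Term.var 0) (succLe (Term.var 1)) v a b ρ))).2 ?_
    refine (iff_of_eq (congrArg (fun c => F.Sat (push (v (show Fin 2 from 0)) (push c ρ)))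
      (realize_succLe (α := Fin 2) (Term.var 1) v))).2 ?_
    refine h₁ _ _ ((iff_of_eq (congrArg F.Sat
      (extend_leAtom (α := Fin 2) (Term.var 0) (Term.var 1) v a b ρ))).1 ?_)
    exact (iff_of_eq (if_pos ((hdep _ _).2 rfl))).1 (hv _ (List.mem_singleton_self _))

theorem natVal_zero : NatVal (zeroVal M) :=
  (sat_natAtom_zero (α := Fin 0) ![]).1 ((Atom.sat_map incl (natAtom zero) ![]).1
    (hM.closed (prodNZero.map incl) (by simp) ![] (fun _ h => by cases h)))

theorem natVal_succ (a : M) (ha : NatVal a) : NatVal (succVal a) :=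
  (sat_natAtom_succ (α := Fin 1) (Term.var 0) ![a]).1
    ((Atom.sat_map incl (natAtom (succ (Term.var 0))) ![a]).1
    (hM.closed (prodNSucc.map incl) (by simp) ![a] (by
      intro c hc
      rw [List.mem_singleton.1 hc]
      exact (Atom.sat_map incl (natAtom (Term.var 0)) ![a]).2
        ((sat_natAtom (α := Fin 1) (Term.var 0) ![a]).2 ha))))

theorem natVal_induction (F : Form langNLe) (ρ : ℕ → M) (h₀ : F.Sat (push (zeroVal M) ρ))
    (h₁ : ∀ a, F.Sat (push a ρ) → F.Sat (push (succVal a) ρ)) {a : M} (h : NatVal a) :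
    F.Sat (push a ρ) := by
  have hdep := IndDefSystem.mutDep_iff_eq sysNLe_isPremise
  refine (iff_of_eq (congrArg F.Sat (extend_val_one a a ρ))).1
    (hM.induction (mapPred incl ⟨1, NPred.nat⟩) (by simp) (fun _ => Fin.val)
    (fun _ => Fin.val_injective) (fun _ => F) (push a ρ) ?_ ![a]
    ((iff_of_eq (LHom.map_onRelation (M := M) incl _ _)).2 h))
  intro π hπ hπd v hv
  rw [hdep] at hπd
  rcases hπ with rfl | rfl | rfl | rfl
  · refine (iff_of_eq (congrArg F.Sat (extend_natAtom_map (α := Fin 0) zero v a ρ))).2 ?_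
    exact (iff_of_eq (congrArg (fun c => F.Sat (push c ρ)) (realize_zero (α := Fin 0) v))).2 h₀
  · refine (iff_of_eq (congrArg F.Sat
      (extend_natAtom_map (α := Fin 1) (succ (Term.var 0)) v a ρ))).2 ?_
    refine (iff_of_eq (congrArg (fun c => F.Sat (push c ρ))
      (realize_succ (α := Fin 1) (Term.var 0) v))).2 ?_
    refine h₁ _ ((iff_of_eq (congrArg F.Sat
      (extend_natAtom_map (α := Fin 1) (Term.var 0) v a ρ))).1 ?_)
    exact (iff_of_eq (if_pos ((hdep _ _).2 rfl))).1 (hv _ (List.mem_singleton_self _))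
  · exact absurd hπd.symm (mapPred_ne_leSym _)
  · exact absurd hπd.symm (mapPred_ne_leSym _)

theorem isNatModel_of_sysNLe : IsNatModel M where
  zero_mem := natVal_zero hM
  succ_mem := natVal_succ hM
  induction F ρ h₀ h₁ a ha := by
    simp only [← Form.sat_map incl F] at h₀ h₁ ⊢
    exact natVal_induction hM _ ρ h₀ h₁ ha

end LeStructure

/-! ### The 2-Hydra statement in the presence of `≤` -/

section Hydra

variable {M : Type} [langNLe.Structure M] [langN.Structure M] [incl.IsExpansionOn M]

/-- The formula `t ≤ u`. -/
def leForm (t u : langNLe.Term ℕ) : Form langNLe := .atom (leAtom t u)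

/-- The formula `N x`, for a variable `x`, in the extended language. -/
def natForm (x : ℕ) : Form langNLe := (nat (Term.var x)).map incl

/-- The formula `p(x, y)`, for variables `x` and `y`, in the extended language. -/
def pForm (x y : ℕ) : Form langNLe := (p (Term.var x) (Term.var y)).map incl

/-- The constant `0` of the extended language. -/
def zeroLe : langNLe.Term ℕ := incl.onTerm zero

omit [langN.Structure M] [incl.IsExpansionOn M] in
@[simp] theorem sat_leForm (t u : langNLe.Term ℕ) (ρ : ℕ → M) :
    (leForm t u).Sat ρ ↔ LeVal (t.realize ρ) (u.realize ρ) := sat_leAtom t u ρ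

@[simp] theorem sat_natForm (x : ℕ) (ρ : ℕ → M) : (natForm x).Sat ρ ↔ NatVal (ρ x) := by
  simp [natForm, Form.sat_map]

@[simp] theorem sat_pForm (x y : ℕ) (ρ : ℕ → M) : (pForm x y).Sat ρ ↔ PVal (ρ x) (ρ y) := by
  simp [pForm, Form.sat_map]

@[simp] theorem realize_zeroLe (ρ : ℕ → M) : zeroLe.realize ρ = zeroVal M := by
  simp [zeroLe]

variable (hM : sysNLe.IsHenkinModel M)
include hM

theorem natVal_of_leVal {a b : M} (h : LeVal a b) (ha : NatVal a) : NatVal b := by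
  have := leVal_induction hM (.imp (natForm 0) (natForm 1)) (fun _ => a)
    (by simp [Form.Sat, push]) ?_ h
  · simp only [Form.Sat, push, sat_natForm] at this
    exact this ha
  · simp only [Form.Sat, push, sat_natForm]
    exact fun a b h ha => natVal_succ hM _ (h ha)

theorem leVal_cases {a b : M} (h : LeVal a b) : a = b ∨ ∃ c, b = succVal c ∧ LeVal a c := by
  have := leVal_induction hM (.or (.eq (Term.var 0) (Term.var 1))
    (.ex (.and (.eq (Term.var 2) (succLe (Term.var 0))) (leForm (Term.var 1) (Term.var 0)))))
    (fun _ => a) (by simp [Form.Sat, push]) ?_ h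
  · simpa [Form.Sat, push] using this
  · simp only [Form.Sat, push, Term.realize_var, realize_succLe, sat_leForm]
    rintro a b (rfl | ⟨c, rfl, hc⟩)
    · exact Or.inr ⟨a, rfl, leVal_refl hM a⟩
    · exact Or.inr ⟨succVal c, rfl, leVal_succ hM hc⟩

theorem leVal_of_succVal_left {a b : M} (h : LeVal (succVal a) b) : LeVal a b := by
  have := leVal_induction hM (.all (.imp (.eq (Term.var 1) (succLe (Term.var 0)))
    (leForm (Term.var 0) (Term.var 2)))) (fun _ => a) ?_ ?_ h
  · simp only [Form.Sat, push, Term.realize_var, realize_succLe, sat_leForm] at this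
    exact this a rfl
  · simp only [Form.Sat, push, Term.realize_var, realize_succLe, sat_leForm]
    rintro _ x rfl
    exact leVal_succ hM (leVal_refl hM x)
  · simp only [Form.Sat, push, Term.realize_var, realize_succLe, sat_leForm]
    intro a b h x hx
    exact leVal_succ hM (h x hx)

theorem succVal_leVal_succVal {a b : M} (h : LeVal a b) : LeVal (succVal a) (succVal b) := by
  have := leVal_induction hM (leForm (succLe (Term.var 0)) (succLe (Term.var 1))) (fun _ => a)
    (by simpa using fun a => leVal_refl hM _) (by simpa using fun a b h => leVal_succ hM h) h
  simpa using this

theorem zero_leVal {a : M} (ha : NatVal a) : LeVal (zeroVal M) a := by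
  have := natVal_induction hM (leForm zeroLe (Term.var 0)) (fun _ => a)
    (by simpa using leVal_refl hM _) (by simpa using fun b h => leVal_succ hM h) ha
  simpa using this

theorem natVal_cases {a : M} (ha : NatVal a) : a = zeroVal M ∨ ∃ b, NatVal b ∧ a = succVal b := by
  have := natVal_induction hM (.or (.eq (Term.var 0) zeroLe)
    (.ex (.and (natForm 0) (.eq (Term.var 1) (succLe (Term.var 0)))))) (fun _ => a)
    (by simp [Form.Sat]) ?_ ha
  · simpa [Form.Sat, push] using this
  · simp only [Form.Sat, push, Term.realize_var, realize_succLe, realize_zeroLe, sat_natForm]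
    rintro _ (rfl | ⟨b, hb, rfl⟩)
    · exact Or.inr ⟨_, natVal_zero hM, rfl⟩
    · exact Or.inr ⟨_, natVal_succ hM _ hb, rfl⟩

theorem exists_leVal_leVal {a b : M} (ha : NatVal a) (hb : NatVal b) :
    ∃ c, NatVal c ∧ LeVal a c ∧ LeVal b c := by
  have := natVal_induction hM (.ex (.and (natForm 0) (.and (leForm (Term.var 2) (Term.var 0))
    (leForm (Term.var 1) (Term.var 0))))) (fun _ => a) ?_ ?_ hb
  · simpa [Form.Sat, push] using this
  · simp only [Form.Sat, push, Term.realize_var, sat_leForm, sat_natForm]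
    exact ⟨a, ha, leVal_refl hM a, zero_leVal hM ha⟩
  · simp only [Form.Sat, push, Term.realize_var, sat_leForm, sat_natForm]
    rintro b ⟨c, hc, hac, hbc⟩
    exact ⟨succVal c, natVal_succ hM c hc, leVal_succ hM hac, succVal_leVal_succVal hM hbc⟩

variable (h0 : ∀ x : M, NatVal x → succVal x ≠ zeroVal M)
  (hs : ∀ x y : M, NatVal x → NatVal y → succVal x = succVal y → x = y)

include h0 in
theorem eq_zero_of_leVal_zero {a : M} (ha : NatVal a) (h : LeVal a (zeroVal M)) :
    a = zeroVal M := by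
  rcases leVal_cases hM h with h | ⟨c, hc, hac⟩
  · exact h
  · exact absurd hc.symm (h0 c (natVal_of_leVal hM hac ha))

include hs in
theorem leVal_of_succVal_leVal_succVal {a b : M} (ha : NatVal a) (hb : NatVal b)
    (h : LeVal (succVal a) (succVal b)) : LeVal a b := by
  rcases leVal_cases hM h with h | ⟨c, hc, hac⟩
  · rw [hs a b ha hb h]
    exact leVal_refl hM b
  · rw [hs b c hb (natVal_of_leVal hM hac (natVal_succ hM a ha)) hc]
    exact leVal_of_succVal_left hM hac

include h0 hs in
/-- Each rule of the game lowers the maximum of the two heads, so induction on a common bound,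
which is what `≤` makes expressible, proves the 2-Hydra statement. -/
theorem pVal_of_hydraHyp (hH : HydraHyp M) {x y : M} (hx : NatVal x) (hy : NatVal y) :
    PVal x y := by
  have key : ∀ n : M, NatVal n → ∀ x y, NatVal x → NatVal y → LeVal x n → LeVal y n →
      PVal x y := by
    intro n hn
    have := natVal_induction hM (.and (natForm 0) (.all (.all (.imp (natForm 1) (.imp (natForm 0)
      (.imp (leForm (Term.var 1) (Term.var 2)) (.imp (leForm (Term.var 0) (Term.var 2))
        (pForm 1 0)))))))) (fun _ => n) ?_ ?_ hn
    · simp only [Form.Sat, push, Term.realize_var, sat_leForm, sat_natForm, sat_pForm] at this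
      exact this.2
    · simp only [Form.Sat, push, Term.realize_var, sat_leForm, sat_natForm, sat_pForm]
      refine ⟨natVal_zero hM, fun x y hx hy hxn hyn => ?_⟩
      rw [eq_zero_of_leVal_zero hM h0 hx hxn, eq_zero_of_leVal_zero hM h0 hy hyn]
      exact hH.zero_zero
    · simp only [Form.Sat, push, Term.realize_var, sat_leForm, sat_natForm, sat_pForm]
      rintro n ⟨hn, ih⟩
      refine ⟨natVal_succ hM n hn, fun x y hx hy hxn hyn => ?_⟩
      rcases natVal_cases hM hy with rfl | ⟨y, hy₁, rfl⟩
      · rcases natVal_cases hM hx with rfl | ⟨x, hx₁, rfl⟩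
        · exact hH.zero_zero
        · rcases natVal_cases hM hx₁ with rfl | ⟨x, hx₂, rfl⟩
          · exact hH.one_zero
          · have h := leVal_of_succVal_leVal_succVal hM hs hx₁ hn hxn
            exact hH.step_zero_right x hx₂ (ih _ _ hx₁ hx₂ h (leVal_of_succVal_left hM h))
      · rcases natVal_cases hM hy₁ with rfl | ⟨y, hy₂, rfl⟩
        · exact hH.one_right x hx
        · have h := leVal_of_succVal_leVal_succVal hM hs hy₁ hn hyn
          have h' := leVal_of_succVal_left hM h
          rcases natVal_cases hM hx with rfl | ⟨x, hx₁, rfl⟩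
          · exact hH.step_zero_left y hy₂ (ih _ _ hy₁ hy₂ h h')
          · exact hH.step x y hx₁ hy₂ (ih _ _ hx₁ hy₂
              (leVal_of_succVal_leVal_succVal hM hs hx₁ hn hxn) h')
  obtain ⟨n, hn, hxn, hyn⟩ := exists_leVal_leVal hM hx hy
  exact key n hn x y hx hy hxn hyn

end Hydra

/-! ### Transfer between the two systems -/

instance (k : ℕ) : Countable (NFunc k) := by
  have : Subsingleton (NFunc k) := ⟨by rintro ⟨⟩ b <;> cases b <;> rfl⟩
  infer_instance

instance (k : ℕ) : Countable (NPred k) := by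
  have : Subsingleton (NPred k) := ⟨by rintro ⟨⟩ b <;> cases b <;> rfl⟩
  infer_instance

instance (k : ℕ) : Countable (LePred k) := by
  have : Subsingleton (LePred k) := ⟨by rintro ⟨⟩ b; cases b; rfl⟩
  infer_instance

instance : Countable (Form langNLe) := by
  have h₁ : Countable (Σ k, langNLe.Functions k) :=
    inferInstanceAs (Countable (Σ k, NFunc k ⊕ Empty))
  have h₂ : Countable (Σ k, langNLe.Relations k) :=
    inferInstanceAs (Countable (Σ k, NPred k ⊕ LePred k))
  infer_instance

theorem valid_mapAll {L L' : FirstOrder.Language.{0, 0}} (φ : L →ᴸ L') {M : Type} [L.Structure M]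
    [L'.Structure M] [φ.IsExpansionOn M] (Γ Δ : Finset (Form L)) :
    Valid M (mapAll φ Γ) (mapAll φ Δ) ↔ Valid M Γ Δ := by
  simp [Valid, mapAll, Form.sat_map]

theorem sysNLe_provable_mapAll {Γ Δ : Finset (Form langN)}
    (h : ∀ (M : Type) [langNLe.Structure M] [langN.Structure M] [incl.IsExpansionOn M],
      sysNLe.IsHenkinModel M → Valid M Γ Δ) :
    sysNLe.Provable (mapAll incl Γ) (mapAll incl Δ) := by
  have : Countable (Form sysNLe.L) := inferInstanceAs (Countable (Form langNLe))
  refine IndDefSystem.provable_of_valid fun M inst _ hM => ?_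
  let inst' : langNLe.Structure M := inst
  let _ : langN.Structure M := incl.reduct M
  have : incl.IsExpansionOn M := incl.isExpansionOn_reduct M
  exact (valid_mapAll (M := M) incl Γ Δ).2 (h M hM)

theorem isExtension_incl : IsExtension sysN sysNLe incl where
  injective := LHom.sumInl_injective
  ind_iff := by
    intro P
    constructor
    · rintro (h | h)
      · obtain ⟨k, P⟩ := P
        cases P
        · rfl
        · cases h
      · exact absurd h (mapPred_ne_leSym P)
    · rintro rfl
      exact Or.inl rfl
  prods_subset := by
    rintro π (rfl | rfl)
    · exact Or.inl rfl
    · exact Or.inr (Or.inl rfl)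
  provable Γ Δ h := sysNLe_provable_mapAll fun M _ _ _ hM =>
    h.sound (isNatModel_of_sysNLe hM).isHenkinModel

theorem sysNLe_provable_hydra :
    sysNLe.Provable (mapAll incl {zeroAx, succAx}) (mapAll incl {hydra}) := by
  refine sysNLe_provable_mapAll fun M _ _ _ hM ρ hρ => ⟨hydra, by simp, ?_⟩
  have h0 := (sat_zeroAx ρ).1 (hρ zeroAx (by simp))
  have hs := (sat_succAx ρ).1 (hρ succAx (by simp))
  exact (sat_hydra (natVal_zero hM) ρ).2 fun hH x y hx hy => pVal_of_hydraHyp hM h0 hs hH hx hy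

/-! ### The countermodel `ℕ + ℤ` -/

/-- The universe of the countermodel: the standard numbers followed by one copy of `ℤ`, whose
element `z` is thought of as `ω + z`. -/
abbrev NatInt : Type := ℕ ⊕ ℤ

namespace NatInt

/-- The successor function. -/
def suc : NatInt → NatInt
  | .inl n => .inl (n + 1)
  | .inr z => .inr (z + 1)

/-- The doubling function, whose graph is the complement of `p`.  It doubles the offset; it
exchanges the two half-lines `ℕ` and `ω + ℕ` and maps the half-line below `ω` to itself. -/
def dbl : NatInt → NatInt
  | .inl n => .inr (2 * n)
  | .inr z => if 0 ≤ z then .inl (2 * z).toNat else .inr (2 * z)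

/-- The offset of `n` is `n`, and that of `ω + z` is `z`. -/
def offset : NatInt → ℤ
  | .inl n => n
  | .inr z => z

/-- The half-line of an element: `0` for `ℕ`, `1` for `ω + ℕ`, and `2` for the elements
below `ω`. -/
def tag : NatInt → Fin 3
  | .inl _ => 0
  | .inr z => if 0 ≤ z then 1 else 2

/-- The action of `dbl` on the half-lines. -/
def flip : Fin 3 → Fin 3
  | 0 => 1
  | 1 => 0
  | 2 => 2

theorem flip_flip (t : Fin 3) : flip (flip t) = t := by
  fin_cases t <;> rfl

theorem flip_injective : Function.Injective flip := Function.LeftInverse.injective flip_flip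

theorem flip_iterate_injective (k : ℕ) : Function.Injective flip^[k] := flip_injective.iterate k

theorem flip_iterate_comm (k l : ℕ) (t : Fin 3) :
    flip^[k] (flip^[l] t) = flip^[l] (flip^[k] t) := by
  rw [← Function.iterate_add_apply, ← Function.iterate_add_apply, add_comm]

theorem flip_iterate_eq_two (k : ℕ) (t : Fin 3) : flip^[k] t = 2 ↔ t = 2 := by
  have h : flip^[k] 2 = 2 := Function.iterate_fixed rfl k
  conv_lhs => rw [← h]
  exact (flip_iterate_injective k).eq_iff

@[simp] theorem offset_suc (x : NatInt) : offset (suc x) = offset x + 1 := by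
  rcases x with n | z <;> simp [suc, offset]

@[simp] theorem offset_suc_iterate (c : ℕ) (x : NatInt) : offset (suc^[c] x) = offset x + c := by
  induction c with
  | zero => simp
  | succ c ih => rw [Function.iterate_succ_apply', offset_suc, ih]; push_cast; ring

@[simp] theorem offset_dbl (x : NatInt) : offset (dbl x) = 2 * offset x := by
  rcases x with n | z
  · rfl
  · simp only [dbl]
    split_ifs with h
    · simp only [offset]; omega
    · rfl

@[simp] theorem tag_dbl (x : NatInt) : tag (dbl x) = flip (tag x) := by
  rcases x with n | z
  · simp only [dbl, tag]
    rw [if_pos (by omega)]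
    rfl
  · simp only [dbl, tag]
    split_ifs with h
    · rfl
    · simp only
      rw [if_neg (by omega)]
      rfl

theorem tag_eq_two (x : NatInt) : tag x = 2 ↔ offset x < 0 := by
  rcases x with n | z
  · simp [tag, offset]
  · simp only [tag, offset]
    split_ifs with h
    · simpa using h
    · simpa using h

theorem ext {x y : NatInt} (h : offset x = offset y) (ht : tag x = tag y) : x = y := by
  rcases x with n | z <;> rcases y with m | w
  · simpa [offset] using h
  · simp only [tag] at ht
    split_ifs at ht <;> simp at ht
  · simp only [tag] at ht
    split_ifs at ht <;> simp at ht
  · simpa [offset] using h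

theorem exists_offset_tag (z : ℤ) (t : Fin 3) (h : t = 2 ↔ z < 0) :
    ∃ x, offset x = z ∧ tag x = t := by
  by_cases hz : z < 0
  · exact ⟨.inr z, rfl, by rw [h.2 hz, tag_eq_two]; exact hz⟩
  · have ht : t = 0 ∨ t = 1 := by
      have := mt h.1 hz
      omega
    rcases ht with rfl | rfl
    · exact ⟨.inl z.toNat, by simp only [offset]; omega, rfl⟩
    · exact ⟨.inr z, rfl, by simp only [tag]; rw [if_pos (by omega)]⟩

theorem tag_suc_iterate (c : ℕ) (x : NatInt) (h : (c : ℤ) < |offset x|) :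
    tag (suc^[c] x) = tag x := by
  rcases x with n | z
  · have : ∀ c n, suc^[c] (.inl n) = .inl (n + c) := by
      intro c
      induction c with
      | zero => intro n; rfl
      | succ c ih => intro n; rw [Function.iterate_succ_apply, suc, ih]; congr 1; omega
    rw [this]
    rfl
  · have : ∀ (c : ℕ) z, suc^[c] (.inr z) = .inr (z + c) := by
      intro c
      induction c with
      | zero => intro n; simp
      | succ c ih =>
        intro n; rw [Function.iterate_succ_apply, suc, ih]; congr 1; push_cast; ring
    rw [this]
    simp only [tag, offset] at h ⊢
    rcases le_or_gt 0 z with hz | hz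
    · rw [if_pos hz, if_pos (by omega)]
    · rw [abs_of_neg hz] at h
      rw [if_neg (by omega), if_neg (by omega)]

instance : langN.Structure NatInt where
  funMap {k} f := match k, f with
    | _, NFunc.zero => fun _ => .inl 0
    | _, NFunc.succ => fun v => suc (v 0)
  RelMap {k} R := match k, R with
    | _, NPred.nat => fun _ => True
    | _, NPred.p => fun v => v 1 ≠ dbl (v 0)

theorem zeroVal_eq : zeroVal NatInt = .inl 0 := rfl

theorem succVal_eq (x : NatInt) : succVal x = suc x := rfl

theorem natVal (x : NatInt) : NatVal x := trivial

theorem pVal_iff (x y : NatInt) : PVal x y ↔ y ≠ dbl x := Iff.rfl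

theorem suc_ne_zero (x : NatInt) : suc x ≠ .inl 0 := by
  rcases x with n | z <;> simp [suc]

theorem suc_injective : Function.Injective suc := by
  rintro (n | z) (m | w) h <;> simp_all [suc]

theorem hydraHyp : HydraHyp NatInt := by
  constructor
  · simp [pVal_iff, zeroVal_eq, dbl]
  · simp [pVal_iff, zeroVal_eq, succVal_eq, suc, dbl]
  · intro x _
    rw [pVal_iff]
    intro h
    have := congrArg offset h
    simp only [succVal_eq, offset_suc, zeroVal_eq, offset_dbl] at this
    simp only [offset] at this
    omega
  · rintro (n | z) (m | w) _ _ h <;> rw [pVal_iff] at h ⊢ <;> contrapose! h <;>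
      simp only [succVal_eq, suc, dbl] at h ⊢
    · simp at h
    · simp only [Sum.inr.injEq] at h ⊢
      push_cast at h
      omega
    · split_ifs at h ⊢ <;> simp only [Sum.inl.injEq] at h ⊢ <;> omega
    · split_ifs at h ⊢ <;> simp only [Sum.inr.injEq] at h ⊢ <;> omega
  · rintro (n | z) _ h <;> rw [pVal_iff] at h ⊢ <;> contrapose! h <;>
      simp only [succVal_eq, suc, dbl, zeroVal_eq] at h ⊢
    · simp at h
    · simp only [Sum.inr.injEq] at h
      rw [if_neg (by push_cast at h; omega)]
      simp only [Sum.inr.injEq]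
      push_cast at h
      omega
  · rintro (n | z) _ h <;> rw [pVal_iff] at h ⊢ <;> contrapose! h <;>
      simp only [succVal_eq, suc, dbl, zeroVal_eq] at h ⊢
    · simp at h
    · split_ifs at h ⊢ <;> simp only [Sum.inl.injEq, Sum.inr.injEq] at h ⊢ <;> omega

theorem not_sat_hydra (ρ : ℕ → NatInt) : ¬ hydra.Sat ρ := by
  rw [sat_hydra (natVal _)]
  intro h
  exact h hydraHyp (.inl 0) (.inr 0) (natVal _) (natVal _) rfl

/-! ### Back-and-forth in the countermodel -/

/-- Every coincidence `2^m y = 2^l x + c` with `l, m ≤ K` and `|c| ≤ B` between `x` and `y` (read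
for offsets, on matching half-lines) also holds between `x'` and `y'`. -/
def NearImp (K : ℕ) (B : ℤ) (x y x' y' : NatInt) : Prop :=
  ∀ l ≤ K, ∀ m ≤ K, |2 ^ m * offset y - 2 ^ l * offset x| ≤ B →
    flip^[l] (tag x) = flip^[m] (tag y) →
    2 ^ m * offset y' - 2 ^ l * offset x' = 2 ^ m * offset y - 2 ^ l * offset x ∧
      flip^[l] (tag x') = flip^[m] (tag y')

theorem NearImp.symm {K : ℕ} {B : ℤ} {x y x' y' : NatInt} (h : NearImp K B x y x' y') :
    NearImp K B y x y' x' := by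
  intro l hl m hm hB ht
  obtain ⟨h₁, h₂⟩ := h m hm l hl (by rwa [abs_sub_comm]) ht.symm
  exact ⟨by linarith, h₂.symm⟩

theorem NearImp.refl (K : ℕ) (B : ℤ) (x y : NatInt) : NearImp K B x y x y :=
  fun _ _ _ _ _ ht => ⟨rfl, ht⟩

theorem NearImp.mono {K K' : ℕ} {B B' : ℤ} (hK : K ≤ K') (hB : B ≤ B') {x y x' y' : NatInt}
    (h : NearImp K' B' x y x' y') : NearImp K B x y x' y' :=
  fun l hl m hm hc ht => h l (hl.trans hK) m (hm.trans hK) (hc.trans hB) ht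

theorem two_pow_pos (k : ℕ) : (1 : ℤ) ≤ 2 ^ k := one_le_pow₀ (by norm_num)

theorem two_pow_le {k K : ℕ} (h : k ≤ K) : (2 : ℤ) ^ k ≤ 2 ^ K :=
  pow_le_pow_right₀ (by norm_num) h

theorem abs_le_abs_two_pow_mul (k : ℕ) (z : ℤ) : |z| ≤ |2 ^ k * z| := by
  rw [abs_mul, abs_of_pos (show (0 : ℤ) < 2 ^ k by positivity)]
  exact le_mul_of_one_le_left (abs_nonneg z) (two_pow_pos k)

theorem abs_two_pow_mul_le {k K : ℕ} (h : k ≤ K) (z : ℤ) : |2 ^ k * z| ≤ 2 ^ K * |z| := by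
  rw [abs_mul, abs_of_pos (show (0 : ℤ) < 2 ^ k by positivity)]
  exact mul_le_mul_of_nonneg_right (two_pow_le h) (abs_nonneg z)

/-- An element with a large offset coincides with itself only trivially. -/
theorem nearImp_self {K : ℕ} {B : ℤ} {a : NatInt} (h : B < |offset a|) (b : NatInt) :
    NearImp K B a a b b := by
  intro l _ m _ hc _
  suffices l = m by subst this; simp
  by_contra hne
  refine absurd hc (not_le.2 (h.trans_le ?_))
  rw [← sub_mul, abs_mul]
  refine le_mul_of_one_le_left (abs_nonneg _) ?_
  refine Int.one_le_abs (sub_ne_zero.2 fun e => hne ?_)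
  exact (Nat.pow_right_injective le_rfl (by exact_mod_cast e)).symm

/-- If `a` is linked to `z` in the same way as `b` is to `z'`, then the coincidences of `a` with `x`
carry over to `b` and `x'`, provided those of `z` with `x` carry over to `z'` and `x'`. -/
theorem NearImp.link {K : ℕ} {B : ℤ} {x z x' z' a b : NatInt} {l₀ m₀ : ℕ} (hl₀ : l₀ ≤ K)
    (hm₀ : m₀ ≤ K) (he : |2 ^ m₀ * offset a - 2 ^ l₀ * offset z| ≤ B)
    (he' : 2 ^ m₀ * offset b - 2 ^ l₀ * offset z' = 2 ^ m₀ * offset a - 2 ^ l₀ * offset z)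
    (ht : flip^[l₀] (tag z) = flip^[m₀] (tag a)) (ht' : flip^[l₀] (tag z') = flip^[m₀] (tag b))
    (h : NearImp (2 * K) (2 ^ K * (2 * B)) x z x' z') : NearImp K B x a x' b := by
  intro l hl m hm hc htag
  have hid : 2 ^ (m + l₀) * offset z - 2 ^ (m₀ + l) * offset x =
      2 ^ m₀ * (2 ^ m * offset a - 2 ^ l * offset x) -
        2 ^ m * (2 ^ m₀ * offset a - 2 ^ l₀ * offset z) := by ring
  obtain ⟨h₁, h₂⟩ := h (m₀ + l) (by omega) (m + l₀) (by omega) (by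
    rw [hid]
    refine (abs_sub _ _).trans ?_
    have e₁ := (abs_two_pow_mul_le hm₀ (2 ^ m * offset a - 2 ^ l * offset x)).trans
      (mul_le_mul_of_nonneg_left hc (by positivity))
    have e₂ := (abs_two_pow_mul_le hm (2 ^ m₀ * offset a - 2 ^ l₀ * offset z)).trans
      (mul_le_mul_of_nonneg_left he (by positivity))
    linarith) (by
    rw [Function.iterate_add_apply, Function.iterate_add_apply, htag, ht, flip_iterate_comm])
  constructor
  · refine mul_left_cancel₀ (pow_ne_zero m₀ (two_ne_zero (α := ℤ))) ?_
    have : 2 ^ m₀ * (2 ^ m * offset b - 2 ^ l * offset x') =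
        (2 ^ (m + l₀) * offset z' - 2 ^ (m₀ + l) * offset x') +
          2 ^ m * (2 ^ m₀ * offset b - 2 ^ l₀ * offset z') := by ring
    rw [this, h₁, he', hid]
    ring
  · rw [Function.iterate_add_apply, Function.iterate_add_apply, ht', flip_iterate_comm m] at h₂
    exact flip_iterate_injective m₀ h₂

/-- The first `n` values of `σ` look like those of `ρ` up to the precision `K`, `B`: they agree
modulo `2^K`, they agree outright where `ρ` is close to `0` or `ω`, and they satisfy all bounded
coincidences that `ρ` satisfies. -/
structure Approx (K : ℕ) (B : ℤ) (n : ℕ) (ρ σ : ℕ → NatInt) : Prop where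
  dvd : ∀ i < n, (2 ^ K : ℤ) ∣ offset (σ i) - offset (ρ i)
  small : ∀ i < n, |offset (ρ i)| ≤ B → σ i = ρ i
  near : ∀ i < n, ∀ j < n, NearImp K B (ρ i) (ρ j) (σ i) (σ j)

theorem Approx.refl (K : ℕ) (B : ℤ) (n : ℕ) (ρ : ℕ → NatInt) : Approx K B n ρ ρ :=
  ⟨fun _ _ => by simp, fun _ _ _ => rfl, fun _ _ _ _ => .refl _ _ _ _⟩

theorem Approx.mono {K K' : ℕ} {B B' : ℤ} {n n' : ℕ} (hK : K ≤ K') (hB : B ≤ B') (hn : n ≤ n')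
    {ρ σ : ℕ → NatInt} (h : Approx K' B' n' ρ σ) : Approx K B n ρ σ :=
  ⟨fun i hi => (pow_dvd_pow 2 hK).trans (h.dvd i (hi.trans_le hn)),
    fun i hi hs => h.small i (hi.trans_le hn) (hs.trans hB),
    fun i hi j hj => (h.near i (hi.trans_le hn) j (hj.trans_le hn)).mono hK hB⟩

theorem Approx.push {K : ℕ} {B : ℤ} {n : ℕ} {ρ σ : ℕ → NatInt} (h : Approx K B n ρ σ)
    {a b : NatInt} (hd : (2 ^ K : ℤ) ∣ offset b - offset a) (hs : |offset a| ≤ B → b = a)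
    (hn : ∀ i < n, NearImp K B (ρ i) a (σ i) b) :
    Approx K B (n + 1) (push a ρ) (push b σ) := by
  refine ⟨?_, ?_, ?_⟩
  · rintro (_ | i) hi
    · exact hd
    · exact h.dvd i (by omega)
  · rintro (_ | i) hi
    · exact hs
    · exact h.small i (by omega)
  · rintro (_ | i) hi (_ | j) hj
    · by_cases ha : |offset a| ≤ B
      · rw [hs ha]
        exact .refl _ _ _ _
      · exact nearImp_self (not_le.1 ha) b
    · exact (hn j (by omega)).symm
    · exact hn i (by omega)
    · exact h.near i (by omega) j (by omega)

/-- An element very far from finitely many others is near to none of them. -/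
theorem nearImp_of_far {K : ℕ} {B : ℤ} {x a : NatInt} (h : B + 2 ^ K * |offset x| < |offset a|)
    (x' b : NatInt) : NearImp K B x a x' b := by
  intro l hl m _ hc _
  have h₁ := abs_le_abs_two_pow_mul m (offset a)
  have h₂ := abs_two_pow_mul_le hl (offset x)
  have h₃ := abs_sub_abs_le_abs_sub (2 ^ m * offset a) (2 ^ l * offset x)
  linarith

theorem exists_bound_offset (n : ℕ) (ρ : ℕ → NatInt) : ∃ C : ℤ, ∀ i < n, |offset (ρ i)| ≤ C := by
  obtain ⟨C, hC⟩ := ((Finset.range n).image fun i => |offset (ρ i)|).bddAbove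
  exact ⟨C, fun i hi => hC (by
    simp only [Finset.coe_image, Set.mem_image, Finset.mem_coe, Finset.mem_range]
    exact ⟨i, hi, rfl⟩)⟩

/-- Every residue class modulo `2^K` has arbitrarily large standard elements. -/
theorem exists_standard_congr (K : ℕ) (z C : ℤ) :
    ∃ k : ℕ, C < k ∧ (2 ^ K : ℤ) ∣ k - z := by
  have h₁ := two_pow_pos K
  refine ⟨(z + 2 ^ K * (|C| + |z| + 1)).toNat, ?_, ?_⟩
  all_goals
    have h₂ : |C| + |z| + 1 ≤ 2 ^ K * (|C| + |z| + 1) :=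
      le_mul_of_one_le_left (by positivity) h₁
    have h₃ := neg_abs_le z
    have h₄ := le_abs_self C
    have h₅ := abs_nonneg C
    rw [Int.toNat_of_nonneg (by linarith)]
  · linarith
  · exact ⟨|C| + |z| + 1, by ring⟩

/-- The back-and-forth step. -/
theorem exists_push {K : ℕ} {B : ℤ} (hB : 0 ≤ B) : ∃ B', B ≤ B' ∧ ∀ (n : ℕ) (ρ σ : ℕ → NatInt),
    Approx (2 * K) B' n ρ σ → Approx (2 * K) B' n σ ρ → ∀ a, ∃ b,
      Approx K B (n + 1) (push a ρ) (push b σ) ∧ Approx K B (n + 1) (push b σ) (push a ρ) := by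
  have hE := two_pow_pos K
  -- `B₂` bounds the elements a link of size `B` may connect to one of size `B`, and `B₁` those that
  -- it may connect to one of size `B₂`.
  set B₂ : ℤ := B + 2 ^ K * B with hB₂
  set B₁ : ℤ := B + 2 ^ K * B₂ with hB₁
  set B' : ℤ := B + 2 ^ K * B₁ + 2 ^ K * (2 * B) with hB'
  have hE₀ : (0 : ℤ) ≤ 2 ^ K := by positivity
  have hEB : B ≤ 2 ^ K * B := le_mul_of_one_le_left hB hE
  have hB₂' : 0 ≤ B₂ := by positivity
  have hEB₂ : B₂ ≤ 2 ^ K * B₂ := le_mul_of_one_le_left hB₂' hE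
  have hB₁' : 0 ≤ B₁ := by positivity
  have hEB₁ : B₁ ≤ 2 ^ K * B₁ := le_mul_of_one_le_left hB₁' hE
  have hlink : 2 ^ K * (2 * B) ≤ B' := by linarith [mul_nonneg hE₀ hB₁']
  have hle : B ≤ B' := by linarith [mul_nonneg hE₀ hB]
  refine ⟨B', hle, fun n ρ σ h h' a => ?_⟩
  have hm := h.mono (by omega : K ≤ 2 * K) hle le_rfl
  have hm' := h'.mono (by omega : K ≤ 2 * K) hle le_rfl
  by_cases hsmall : |offset a| ≤ B₁
  · -- `a` is close to `0` or `ω`: answer with `a` itself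
    have key : ∀ ρ σ : ℕ → NatInt, Approx (2 * K) B' n ρ σ → ∀ i < n,
        NearImp K B (ρ i) a (σ i) a := by
      intro ρ σ h i hi
      by_cases hf : B + 2 ^ K * |offset a| < |offset (ρ i)|
      · exact (nearImp_of_far hf _ _).symm
      · rw [h.small i hi]
        · exact .refl _ _ _ _
        · have := mul_le_mul_of_nonneg_left hsmall hE₀
          have := mul_nonneg hE₀ (mul_nonneg zero_le_two hB)
          linarith
    exact ⟨a, hm.push (by simp) (fun _ => rfl) (key ρ σ h),
      hm'.push (by simp) (fun _ => rfl) (key σ ρ h')⟩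
  rw [not_le] at hsmall
  by_cases hnear : ∃ i < n, ∃ l₀ ≤ K, ∃ m₀ ≤ K,
      |2 ^ m₀ * offset a - 2 ^ l₀ * offset (ρ i)| ≤ B ∧
        flip^[l₀] (tag (ρ i)) = flip^[m₀] (tag a)
  · -- `a` is linked to some `ρ i`: answer with the element linked to `σ i` in the same way
    obtain ⟨i, hi, l₀, hl₀, m₀, hm₀, he, ht⟩ := hnear
    set e := 2 ^ m₀ * offset a - 2 ^ l₀ * offset (ρ i) with he_def
    have hσ : B₂ < |offset (σ i)| := by
      by_contra hcon
      rw [not_lt] at hcon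
      have heq := h'.small i hi (by linarith [mul_nonneg hE₀ hB])
      have h₁ := abs_le_abs_two_pow_mul m₀ (offset a)
      have h₂ := abs_two_pow_mul_le hl₀ (offset (ρ i))
      have h₃ := abs_sub_abs_le_abs_sub (2 ^ m₀ * offset a) (2 ^ l₀ * offset (ρ i))
      rw [← heq] at hcon
      have h₄ := mul_le_mul_of_nonneg_left hcon hE₀
      linarith
    obtain ⟨q, hq⟩ := h.dvd i hi
    have hpow : (2 : ℤ) ^ m₀ * 2 ^ (2 * K - m₀) = 2 ^ (2 * K) := by
      rw [← pow_add]
      congr 1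
      omega
    set c : ℤ := offset a + 2 ^ l₀ * (2 ^ (2 * K - m₀) * q) with hc
    have hce : 2 ^ m₀ * c - 2 ^ l₀ * offset (σ i) = e := by
      have : offset (σ i) = offset (ρ i) + 2 ^ (2 * K) * q := by linarith
      rw [this, he_def, hc, ← hpow]
      ring
    have hsign : tag (σ i) = 2 ↔ c < 0 := by
      rw [tag_eq_two]
      have h₁ := abs_le_abs_two_pow_mul l₀ (offset (σ i))
      have h₂ := abs_le.1 he
      have hpos : (0 : ℤ) < 2 ^ m₀ := by positivity
      have hpos' : (0 : ℤ) < 2 ^ l₀ := by positivity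
      constructor
      · intro hneg
        rw [abs_of_neg (mul_neg_of_pos_of_neg hpos' hneg)] at h₁
        by_contra hcon
        have := mul_nonneg hpos.le (not_lt.1 hcon)
        linarith
      · intro hneg
        by_contra hcon
        rw [abs_of_nonneg (mul_nonneg hpos'.le (not_lt.1 hcon))] at h₁
        have := mul_neg_of_pos_of_neg hpos hneg
        linarith
    obtain ⟨b, hbc, hbt⟩ := exists_offset_tag c (flip^[m₀] (flip^[l₀] (tag (σ i)))) (by
      rw [flip_iterate_eq_two, flip_iterate_eq_two, hsign])
    have ht' : flip^[l₀] (tag (σ i)) = flip^[m₀] (tag b) := by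
      rw [hbt, ← Function.iterate_add_apply flip m₀ m₀, ← two_mul, Function.iterate_mul]
      have : flip^[2] = id := funext flip_flip
      rw [this, Function.iterate_id]
      rfl
    have hd : (2 ^ K : ℤ) ∣ offset b - offset a := by
      rw [hbc, hc, add_sub_cancel_left]
      exact ((pow_dvd_pow 2 (by omega : K ≤ 2 * K - m₀)).mul_right q).mul_left _
    have hblarge : B < |offset b| := by
      have h₁ := abs_le_abs_two_pow_mul l₀ (offset (σ i))
      have h₂ := abs_two_pow_mul_le hm₀ c
      have h₃ := abs_sub_abs_le_abs_sub (2 ^ l₀ * offset (σ i)) (2 ^ m₀ * c)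
      rw [abs_sub_comm, hce] at h₃
      rw [hbc]
      by_contra hcon
      have h₄ := mul_le_mul_of_nonneg_left (not_lt.1 hcon) hE₀
      linarith
    rw [← hbc] at hce
    refine ⟨b, hm.push hd (fun hle => absurd hle (by linarith)) fun j hj => ?_,
      hm'.push (by rwa [← dvd_neg, neg_sub]) (fun hle => absurd hle (by linarith)) fun j hj => ?_⟩
    · exact .link hl₀ hm₀ he hce ht ht' ((h.near j hj i hi).mono le_rfl hlink)
    · exact .link hl₀ hm₀ (by rw [hce]; exact he) (by rw [hce]) ht' ht
        ((h'.near j hj i hi).mono le_rfl hlink)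
  · -- `a` is linked to nothing: answer with a remote standard element of the same residue class
    obtain ⟨C, hC⟩ := exists_bound_offset n σ
    obtain ⟨k, hk, hdk⟩ := exists_standard_congr K (offset a) (B + 2 ^ K * |C|)
    have hoff : |offset (.inl k)| = k := by simp [offset]
    refine ⟨.inl k, hm.push hdk (fun hle => absurd hle (by linarith)) fun i hi => ?_,
      hm'.push (by rw [← dvd_neg, neg_sub]; exact hdk)
        (fun hle => absurd hle (by rw [hoff]; linarith [mul_nonneg hE₀ (abs_nonneg C)]))
        fun i hi => nearImp_of_far ?_ _ _⟩
    · intro l hl m hm hc ht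
      exact absurd ⟨i, hi, l, hl, m, hm, hc, ht⟩ hnear
    · rw [hoff]
      have := mul_le_mul_of_nonneg_left ((hC i hi).trans (le_abs_self C)) hE₀
      linarith

/-! ### Definable sets of the countermodel -/

/-- A term is an iterated successor of `0` or of a variable. -/
theorem term_eq (t : langN.Term ℕ) : ∃ c : ℕ,
    (∀ ρ : ℕ → NatInt, t.realize ρ = suc^[c] (.inl 0)) ∨
      ∃ i, ∀ ρ : ℕ → NatInt, t.realize ρ = suc^[c] (ρ i) := by
  induction t with
  | var i => exact ⟨0, Or.inr ⟨i, fun ρ => rfl⟩⟩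
  | func f ts ih =>
    cases f with
    | zero => exact ⟨0, Or.inl fun ρ => rfl⟩
    | succ =>
      obtain ⟨c, h | ⟨i, h⟩⟩ := ih 0
      · exact ⟨c + 1, Or.inl fun ρ => by
          rw [Function.iterate_succ_apply', ← h ρ]; rfl⟩
      · exact ⟨c + 1, Or.inr ⟨i, fun ρ => by
          rw [Function.iterate_succ_apply', ← h ρ]; rfl⟩⟩

/-- `x'`, `y'` look like `x`, `y` up to the precision `1`, `B`. -/
structure PairApprox (B : ℤ) (x y x' y' : NatInt) : Prop where
  left : |offset x| ≤ B → x' = x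
  right : |offset y| ≤ B → y' = y
  left' : |offset x'| ≤ B → x = x'
  right' : |offset y'| ≤ B → y = y'
  near : NearImp 1 B x y x' y'

/-- Offsets and half-lines of `s^c x` and `s^d y` can be compared without passing `ω`. -/
theorem PairApprox.iterate {B : ℤ} {x y x' y' : NatInt} (h : PairApprox B x y x' y') {c d l : ℕ}
    (hl : l ≤ 1) (hB : 4 * (c + d : ℤ) + 4 ≤ B)
    (heq : suc^[d] y = dbl^[l] (suc^[c] x)) : suc^[d] y' = dbl^[l] (suc^[c] x') := by
  by_cases hs : |offset x| ≤ B ∧ |offset y| ≤ B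
  · rw [h.left hs.1, h.right hs.2, heq]
  have hoff : ∀ z, offset (dbl^[l] z) = 2 ^ l * offset z := by
    intro z
    interval_cases l <;> simp
  have htag : ∀ z, tag (dbl^[l] z) = flip^[l] (tag z) := by
    intro z
    interval_cases l <;> simp
  have ho := congrArg offset heq
  rw [hoff, offset_suc_iterate, offset_suc_iterate] at ho
  have hl' : (2 : ℤ) ^ l = 1 ∨ (2 : ℤ) ^ l = 2 := by
    interval_cases l <;> simp
  have hlarge : (c : ℤ) < |offset x| ∧ (d : ℤ) < |offset y| := by
    rw [not_and_or, not_le, not_le] at hs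
    rw [lt_abs, lt_abs] at hs ⊢
    rcases hl' with e | e <;> rw [e] at ho <;> omega
  have hlarge' : (c : ℤ) < |offset x'| ∧ (d : ℤ) < |offset y'| := by
    constructor
    · by_contra hcon
      rw [not_lt] at hcon
      rw [h.left' (by omega)] at hlarge
      omega
    · by_contra hcon
      rw [not_lt] at hcon
      rw [h.right' (by omega)] at hlarge
      omega
  have ht := congrArg tag heq
  rw [htag, tag_suc_iterate c x hlarge.1, tag_suc_iterate d y hlarge.2] at ht
  obtain ⟨h₁, h₂⟩ := h.near l hl 0 (by omega) (by
    rw [abs_le]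
    rcases hl' with e | e <;> rw [e] at ho ⊢ <;> omega) ht.symm
  refine ext ?_ ?_
  · rw [hoff, offset_suc_iterate, offset_suc_iterate]
    linarith
  · rw [htag, tag_suc_iterate c x' hlarge'.1, tag_suc_iterate d y' hlarge'.2]
    exact h₂.symm

/-- The constant `0` may be added to the tuples compared. -/
theorem pairApprox_of_approx {K : ℕ} {B : ℤ} (hK : 1 ≤ K) {n : ℕ}
    {ρ σ : ℕ → NatInt} (h : Approx K B n ρ σ) (h' : Approx K B n σ ρ) {x y x' y' : NatInt}
    (hx : (x = .inl 0 ∧ x' = .inl 0) ∨ ∃ i < n, x = ρ i ∧ x' = σ i)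
    (hy : (y = .inl 0 ∧ y' = .inl 0) ∨ ∃ i < n, y = ρ i ∧ y' = σ i) :
    PairApprox B x y x' y' := by
  have hone : ∀ {x x'}, ((x = .inl 0 ∧ x' = .inl 0) ∨ ∃ i < n, x = ρ i ∧ x' = σ i) →
      (|offset x| ≤ B → x' = x) ∧ (|offset x'| ≤ B → x = x') := by
    rintro x x' (⟨rfl, rfl⟩ | ⟨i, hi, rfl, rfl⟩)
    · exact ⟨fun _ => rfl, fun _ => rfl⟩
    · exact ⟨h.small i hi, h'.small i hi⟩
  refine ⟨(hone hx).1, (hone hy).1, (hone hx).2, (hone hy).2, ?_⟩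
  have hzero : ∀ {y y'}, ((y = .inl 0 ∧ y' = .inl 0) ∨ ∃ i < n, y = ρ i ∧ y' = σ i) →
      NearImp 1 B (.inl 0) y (.inl 0) y' := by
    intro y y' hy l hl m hm hc ht
    have h₁ := abs_le_abs_two_pow_mul m (offset y)
    have h₂ : offset (.inl 0) = 0 := rfl
    rw [h₂, mul_zero, sub_zero] at hc
    rw [(hone hy).1 (h₁.trans hc)]
    exact ⟨rfl, ht⟩
  rcases hx with ⟨rfl, rfl⟩ | ⟨i, hi, rfl, rfl⟩
  · exact hzero hy
  · rcases hy with ⟨rfl, rfl⟩ | ⟨j, hj, rfl, rfl⟩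
    · exact (hzero (Or.inr ⟨i, hi, rfl, rfl⟩)).symm
    · exact (h.near i hi j hj).mono hK le_rfl

/-- Sufficiently good approximations agree on the equation `u = t` (the case `l = 0`) and on the
negation `u = dbl t` of the atom `p(t, u)` (the case `l = 1`). -/
theorem exists_approx_term (t u : langN.Term ℕ) : ∃ (B : ℤ) (n : ℕ), 0 ≤ B ∧
    ∀ ρ σ : ℕ → NatInt, Approx 1 B n ρ σ → Approx 1 B n σ ρ → ∀ l ≤ 1,
      (u.realize ρ = dbl^[l] (t.realize ρ) ↔ u.realize σ = dbl^[l] (t.realize σ)) := by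
  have hterm : ∀ t : langN.Term ℕ, ∃ c n : ℕ, ∀ ρ σ : ℕ → NatInt, ∃ x x' : NatInt,
      t.realize ρ = suc^[c] x ∧ t.realize σ = suc^[c] x' ∧
        ((x = .inl 0 ∧ x' = .inl 0) ∨ ∃ i < n, x = ρ i ∧ x' = σ i) := by
    intro t
    obtain ⟨c, h | ⟨i, h⟩⟩ := term_eq t
    · exact ⟨c, 0, fun ρ σ => ⟨_, _, h ρ, h σ, Or.inl ⟨rfl, rfl⟩⟩⟩
    · exact ⟨c, i + 1, fun ρ σ => ⟨_, _, h ρ, h σ, Or.inr ⟨i, by omega, rfl, rfl⟩⟩⟩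
  obtain ⟨c, n₁, hc⟩ := hterm t
  obtain ⟨d, n₂, hd⟩ := hterm u
  have key : ∀ ρ σ : ℕ → NatInt, Approx 1 (4 * (c + d : ℤ) + 4) (max n₁ n₂) ρ σ →
      Approx 1 (4 * (c + d : ℤ) + 4) (max n₁ n₂) σ ρ → ∀ l ≤ 1,
      u.realize ρ = dbl^[l] (t.realize ρ) → u.realize σ = dbl^[l] (t.realize σ) := by
    intro ρ σ h h' l hl heq
    obtain ⟨x, x', hx, hx', hxx⟩ := hc ρ σ
    obtain ⟨y, y', hy, hy', hyy⟩ := hd ρ σ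
    rw [hx, hy] at heq
    rw [hx', hy']
    refine (pairApprox_of_approx le_rfl h h' ?_ ?_).iterate hl le_rfl heq
    · exact hxx.imp id fun ⟨i, hi, h⟩ => ⟨i, hi.trans_le (le_max_left _ _), h⟩
    · exact hyy.imp id fun ⟨i, hi, h⟩ => ⟨i, hi.trans_le (le_max_right _ _), h⟩
  exact ⟨4 * (c + d : ℤ) + 4, max n₁ n₂, by positivity, fun ρ σ h h' l hl =>
    ⟨key ρ σ h h' l hl, key σ ρ h' h l hl⟩⟩

/-- A formula cannot distinguish valuations that approximate each other well enough. -/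
theorem exists_approx_form (F : Form langN) : ∃ (K : ℕ) (B : ℤ) (n : ℕ), 0 ≤ B ∧
    ∀ ρ σ : ℕ → NatInt, Approx K B n ρ σ → Approx K B n σ ρ → (F.Sat ρ ↔ F.Sat σ) := by
  have hbin : ∀ {F G : Form langN},
      (∃ (K : ℕ) (B : ℤ) (n : ℕ), 0 ≤ B ∧ ∀ ρ σ : ℕ → NatInt, Approx K B n ρ σ →
        Approx K B n σ ρ → (F.Sat ρ ↔ F.Sat σ)) →
      (∃ (K : ℕ) (B : ℤ) (n : ℕ), 0 ≤ B ∧ ∀ ρ σ : ℕ → NatInt, Approx K B n ρ σ →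
        Approx K B n σ ρ → (G.Sat ρ ↔ G.Sat σ)) →
      ∃ (K : ℕ) (B : ℤ) (n : ℕ), 0 ≤ B ∧ ∀ ρ σ : ℕ → NatInt, Approx K B n ρ σ →
        Approx K B n σ ρ → (F.Sat ρ ↔ F.Sat σ) ∧ (G.Sat ρ ↔ G.Sat σ) := by
    rintro F G ⟨K₁, B₁, n₁, hB₁, h₁⟩ ⟨K₂, B₂, n₂, hB₂, h₂⟩
    refine ⟨max K₁ K₂, max B₁ B₂, max n₁ n₂, hB₁.trans (le_max_left _ _), fun ρ σ h h' => ⟨?_, ?_⟩⟩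
    · exact h₁ ρ σ (h.mono (le_max_left _ _) (le_max_left _ _) (le_max_left _ _))
        (h'.mono (le_max_left _ _) (le_max_left _ _) (le_max_left _ _))
    · exact h₂ ρ σ (h.mono (le_max_right _ _) (le_max_right _ _) (le_max_right _ _))
        (h'.mono (le_max_right _ _) (le_max_right _ _) (le_max_right _ _))
  have hquant : ∀ {F : Form langN},
      (∃ (K : ℕ) (B : ℤ) (n : ℕ), 0 ≤ B ∧ ∀ ρ σ : ℕ → NatInt, Approx K B n ρ σ →
        Approx K B n σ ρ → (F.Sat ρ ↔ F.Sat σ)) →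
      ∃ (K : ℕ) (B : ℤ) (n : ℕ), 0 ≤ B ∧ ∀ ρ σ : ℕ → NatInt, Approx K B n ρ σ →
        Approx K B n σ ρ → ∀ a, ∃ b, F.Sat (push a ρ) ↔ F.Sat (push b σ) := by
    rintro F ⟨K, B, n, hB, h⟩
    obtain ⟨B', hB', hstep⟩ := exists_push (K := K) hB
    refine ⟨2 * K, B', n, hB.trans hB', fun ρ σ h₁ h₂ a => ?_⟩
    obtain ⟨b, h₃, h₄⟩ := hstep n ρ σ h₁ h₂ a
    exact ⟨b, h _ _ (h₃.mono le_rfl le_rfl (by omega)) (h₄.mono le_rfl le_rfl (by omega))⟩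
  induction F with
  | eq t u =>
    obtain ⟨B, n, hB, h⟩ := exists_approx_term u t
    exact ⟨1, B, n, hB, fun ρ σ h₁ h₂ => h ρ σ h₁ h₂ 0 (by omega)⟩
  | atom a =>
    obtain ⟨⟨k, P⟩, t⟩ := a
    cases P with
    | nat => exact ⟨0, 0, 0, le_rfl, fun _ _ _ _ => Iff.rfl⟩
    | p =>
      obtain ⟨B, n, hB, h⟩ := exists_approx_term (t (0 : Fin 2)) (t (1 : Fin 2))
      exact ⟨1, B, n, hB, fun ρ σ h₁ h₂ => not_congr (h ρ σ h₁ h₂ 1 le_rfl)⟩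
  | neg F ih =>
    obtain ⟨K, B, n, hB, h⟩ := ih
    exact ⟨K, B, n, hB, fun ρ σ h₁ h₂ => not_congr (h ρ σ h₁ h₂)⟩
  | and F G ih₁ ih₂ =>
    obtain ⟨K, B, n, hB, h⟩ := hbin ih₁ ih₂
    exact ⟨K, B, n, hB, fun ρ σ h₁ h₂ => and_congr (h ρ σ h₁ h₂).1 (h ρ σ h₁ h₂).2⟩
  | or F G ih₁ ih₂ =>
    obtain ⟨K, B, n, hB, h⟩ := hbin ih₁ ih₂
    exact ⟨K, B, n, hB, fun ρ σ h₁ h₂ => or_congr (h ρ σ h₁ h₂).1 (h ρ σ h₁ h₂).2⟩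
  | imp F G ih₁ ih₂ =>
    obtain ⟨K, B, n, hB, h⟩ := hbin ih₁ ih₂
    exact ⟨K, B, n, hB, fun ρ σ h₁ h₂ => imp_congr (h ρ σ h₁ h₂).1 (h ρ σ h₁ h₂).2⟩
  | all F ih =>
    obtain ⟨K, B, n, hB, h⟩ := hquant ih
    refine ⟨K, B, n, hB, fun ρ σ h₁ h₂ => ⟨fun hF b => ?_, fun hF a => ?_⟩⟩
    · obtain ⟨a, ha⟩ := h σ ρ h₂ h₁ b
      exact ha.2 (hF a)
    · obtain ⟨b, hb⟩ := h ρ σ h₁ h₂ a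
      exact hb.2 (hF b)
  | ex F ih =>
    obtain ⟨K, B, n, hB, h⟩ := hquant ih
    refine ⟨K, B, n, hB, fun ρ σ h₁ h₂ => ⟨fun ⟨a, ha⟩ => ?_, fun ⟨b, hb⟩ => ?_⟩⟩
    · obtain ⟨b, hb⟩ := h ρ σ h₁ h₂ a
      exact ⟨b, hb.1 ha⟩
    · obtain ⟨a, ha⟩ := h σ ρ h₂ h₁ b
      exact ⟨a, ha.1 hb⟩

/-- Far from `0`, `ω` and the parameters, membership in a definable set depends only on the residue
of the offset modulo a power of two. -/
theorem exists_periodic (F : Form langN) (ρ : ℕ → NatInt) : ∃ (K : ℕ) (R : ℤ), ∀ a b : NatInt,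
    R < |offset a| → R < |offset b| → (2 ^ K : ℤ) ∣ offset b - offset a →
      (F.Sat (push a ρ) ↔ F.Sat (push b ρ)) := by
  obtain ⟨K, B, n, hB, h⟩ := exists_approx_form F
  obtain ⟨C, hC⟩ := exists_bound_offset n ρ
  refine ⟨K, B + 2 ^ K * |C|, fun a b ha hb hd => ?_⟩
  have hE₀ : (0 : ℤ) ≤ 2 ^ K := by positivity
  have hC₀ := mul_nonneg hE₀ (abs_nonneg C)
  have hfar : ∀ a b : NatInt, B + 2 ^ K * |C| < |offset a| → ∀ i < n,
      NearImp K B (ρ i) a (ρ i) b := fun a b ha i hi => nearImp_of_far (by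
    have := mul_le_mul_of_nonneg_left ((hC i hi).trans (le_abs_self C)) hE₀
    linarith) _ _
  refine h _ _ (Approx.mono le_rfl le_rfl (by omega : n ≤ n + 1)
      ((Approx.refl K B n ρ).push hd (fun hle => absurd hle (by linarith)) (hfar a b ha)))
    (Approx.mono le_rfl le_rfl (by omega : n ≤ n + 1)
      ((Approx.refl K B n ρ).push (by rwa [← dvd_neg, neg_sub])
        (fun hle => absurd hle (by linarith)) (hfar b a hb)))

/-- A definable set that contains `0` and is closed under successor contains `ℕ`, hence by
periodicity everything far from `ω` and the parameters, hence everything. -/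
theorem isNatModel : IsNatModel NatInt where
  zero_mem := trivial
  succ_mem _ _ := trivial
  induction F ρ h₀ h₁ a _ := by
    have hnat : ∀ n : ℕ, F.Sat (push (.inl n) ρ) := by
      intro n
      induction n with
      | zero => exact h₀
      | succ n ih => exact h₁ _ ih
    obtain ⟨K, R, hR⟩ := exists_periodic F ρ
    have hfar : ∀ x : NatInt, R < |offset x| → F.Sat (push x ρ) := by
      intro x hx
      obtain ⟨k, hk, hd⟩ := exists_standard_congr K (offset x) R
      have hoff : offset (.inl k) = k := rfl
      exact (hR x (.inl k) hx (by rw [hoff, Nat.abs_cast]; exact hk) hd).2 (hnat k)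
    rcases a with n | z
    · exact hnat n
    · have hup : ∀ (w : ℤ) (k : ℕ), F.Sat (push (.inr w) ρ) → F.Sat (push (.inr (w + k)) ρ) := by
        intro w k hw
        induction k with
        | zero => simpa using hw
        | succ k ih =>
          have := h₁ _ ih
          rw [succVal_eq, suc] at this
          rw [Nat.cast_succ, ← add_assoc]
          exact this
      have := hup (-(|z| + |R| + 1)) (z + (|z| + |R| + 1)).toNat (hfar _ (by
        simp only [offset]
        rw [abs_neg, abs_of_nonneg (by positivity)]
        linarith [le_abs_self R, abs_nonneg z]))
      rwa [Int.toNat_of_nonneg (by linarith [neg_abs_le z, abs_nonneg R]),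
        neg_add_cancel_comm_assoc] at this

end NatInt

theorem not_sysN_provable_hydra : ¬ sysN.Provable {zeroAx, succAx} {hydra} := by
  intro h
  obtain ⟨F, hF, hsat⟩ := h.sound NatInt.isNatModel.isHenkinModel (fun _ => .inl 0) (by
    simp only [Finset.mem_insert, Finset.mem_singleton]
    rintro F (rfl | rfl)
    · exact (sat_zeroAx _).2 fun x _ => NatInt.suc_ne_zero x
    · exact (sat_succAx _).2 fun x y _ _ hxy => NatInt.suc_injective hxy)
  rw [Finset.mem_singleton] at hF
  subst hF
  exact NatInt.not_sat_hydra _ hsat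

end LKID

theorem theorem7p4 :
    LKID.IsExtension LKID.sysN LKID.sysNLe LKID.incl ∧
    ¬ LKID.IsConservative LKID.sysN LKID.sysNLe LKID.incl ∧
    LKID.sysNLe.Provable (LKID.mapAll LKID.incl {LKID.zeroAx, LKID.succAx})
      (LKID.mapAll LKID.incl {LKID.hydra}) ∧
    ¬ LKID.sysN.Provable {LKID.zeroAx, LKID.succAx} {LKID.hydra} :=
  ⟨LKID.isExtension_incl,
    fun h => LKID.not_sysN_provable_hydra (h _ _ LKID.sysNLe_provable_hydra),
    LKID.sysNLe_provable_hydra, LKID.not_sysN_provable_hydra⟩
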